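/- **Setting.** Point sets are finite multisets in $\mathbb{R}^d$, with the Euclidean norm. For a nonempty finite multiset $S'$ in $\mathbb{R}^d$ and $\mu\in\mathbb{R}^d$ write $\mu_{S'}=\frac1{|S'|}\sum_{x\in S'}x$ and $\overline\Sigma_{S'}=\frac1{|S'|}\sum_{x\in S'}(x-\mu)(x-\mu)^T$. For $0<\eta<1/2$, $\delta\ge\eta$ and $\sigma>0$, a multiset $S$ is $(\eta,\delta)$-stable with respect to $\mu$ and $\sigma^2$ if every $S'\subseteq S$ with $|S'|\ge(1-\eta)|S|$ satisfies $\|\mu_{S'}-\mu\|\le\sigma\delta$ and $\|\overline\Sigma_{S'}-\sigma^2I\|\le\sigma^2\delta^2/\eta$ (spectral norm). A multiset $T$ is an $\epsilon$-corrupted version of $S$ if it is obtained from $S$ by replacing at most $\epsilon|S|$ of its points by arbitrary points, so $|T|=|S|$. **Theorem.** There are absolute constants $C_0,K>0$ and a single deterministic algorithm with the following properties. The input of the algorithm is $(T,\epsilon)$, where $T$ is a multiset of $n$ points of $\mathbb{R}^d$ ($n$ and $d$ arbitrary) and $\epsilon\in\mathbb{R}$; neither $\sigma$ nor $\delta$ is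 given to it. On every input it halts after a number of steps bounded by a fixed polynomial in $n$ and $d$, where a step is an exact arithmetic operation or comparison of real numbers, or an elementary operation on integer counters and addresses (real RAM without rounding operations). Its output is a vector $\widehat\mu\in\mathbb{R}^d$ such that, whenever $C\ge C_0$, $\sigma>0$, and $T$ is an $\epsilon$-corrupted version of a nonempty multiset $S$ that is $(C\epsilon,\delta)$-stable with respect to $\mu_S$ and $\sigma^2$, $$\|\mu_S-\widehat\mu\|\le K\,\sigma\,\delta .$$ -/

import Mathlib

/-! ### Point sets, stability, corruption -/

/-- `ℝ^d` with the Euclidean norm. -/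
abbrev RVec (d : ℕ) : Type := EuclideanSpace ℝ (Fin d)

/-- A multiset of `n` points of `ℝ^d`, listed as `x 0, …, x (n-1)` (repetitions allowed).
Its sub-multisets are given by the sets of indices. -/
abbrev Points (n d : ℕ) : Type := Fin n → RVec d

/-- The mean of the points with index in `I`, under the uniform distribution on `I`. -/
noncomputable def subMean {n d : ℕ} (x : Points n d) (I : Finset (Fin n)) : RVec d :=
  (I.card : ℝ)⁻¹ • ∑ i ∈ I, x i

/-- The second moment matrix, centered at `μ`, of the points with index in `I`:
`(1/|I|) ∑ (x - μ) (x - μ)ᵀ`. -/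
noncomputable def subSecondMoment {n d : ℕ} (x : Points n d) (μ : RVec d)
    (I : Finset (Fin n)) : Matrix (Fin d) (Fin d) ℝ :=
  (I.card : ℝ)⁻¹ • ∑ i ∈ I, Matrix.vecMulVec (x i - μ).ofLp (x i - μ).ofLp

/-- The spectral norm (operator norm with respect to the Euclidean norm) of a square matrix. -/
noncomputable def matSpectralNorm {d : ℕ} (M : Matrix (Fin d) (Fin d) ℝ) : ℝ :=
  ‖Matrix.toEuclideanCLM (n := Fin d) (𝕜 := ℝ) M‖

/-- The multiset `x` is `(ε, δ)`-stable with respect to `μ` and `σ²`. -/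
structure IsStable {n d : ℕ} (ε δ : ℝ) (x : Points n d) (μ : RVec d) (σ : ℝ) : Prop where
  eps_pos : 0 < ε
  eps_lt : ε < 1 / 2
  eps_le : ε ≤ δ
  mean_close : ∀ I : Finset (Fin n), (1 - ε) * (n : ℝ) ≤ (I.card : ℝ) →
    ‖subMean x I - μ‖ ≤ σ * δ
  secondMoment_close : ∀ I : Finset (Fin n), (1 - ε) * (n : ℝ) ≤ (I.card : ℝ) →
    matSpectralNorm (subSecondMoment x μ I - σ ^ 2 • (1 : Matrix (Fin d) (Fin d) ℝ))
      ≤ σ ^ 2 * δ ^ 2 / ε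

/-- `y` is an `ε`-corrupted version of `x`: it arises by replacing at most `ε n` of the `n`
points by arbitrary points. -/
def IsCorruption {n d : ℕ} (ε : ℝ) (x y : Points n d) : Prop :=
  ({i : Fin n | y i ≠ x i}.ncard : ℝ) ≤ ε * n

/-! ### A real RAM with a step count

Programs are imperative programs over integer registers and two-dimensional arrays of real
numbers. Reals are stored exactly; the operations are `+`, `-`, `*`, `/` and comparison, at unit
cost. There is no rounding operation and no conversion between reals and integers, and the only
literals are rational. Integer registers, used for counting and addressing, admit only addition,
(truncated) subtraction and comparison. -/

namespace RealRAM

/-- A memory state: integer register `r` holds `nat r`, and entry `(i, j)` of array `a` holds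
`real a i j`. -/
structure Store where
  nat : ℕ → ℕ
  real : ℕ → ℕ → ℕ → ℝ

/-- Integer expressions. -/
inductive NExp : Type
  | lit (k : ℕ)
  | reg (r : ℕ)
  | add (e f : NExp)
  | sub (e f : NExp)

namespace NExp

def eval (s : Store) : NExp → ℕ
  | lit k => k
  | reg r => s.nat r
  | add e f => e.eval s + f.eval s
  | sub e f => e.eval s - f.eval s

/-- Number of unit-cost operations in an evaluation. -/
def cost : NExp → ℕ
  | lit _ => 1
  | reg _ => 1
  | add e f => e.cost + f.cost + 1
  | sub e f => e.cost + f.cost + 1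

end NExp

/-- Real expressions; `get a i j` reads entry `(i, j)` of array `a`. -/
inductive RExp : Type
  | lit (q : ℚ)
  | get (a : ℕ) (i j : NExp)
  | add (e f : RExp)
  | sub (e f : RExp)
  | mul (e f : RExp)
  | div (e f : RExp)

namespace RExp

/-- The value of a real expression; division by zero yields zero. -/
noncomputable def eval (s : Store) : RExp → ℝ
  | lit q => (q : ℝ)
  | get a i j => s.real a (i.eval s) (j.eval s)
  | add e f => e.eval s + f.eval s
  | sub e f => e.eval s - f.eval s
  | mul e f => e.eval s * f.eval s
  | div e f => e.eval s / f.eval s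

/-- Number of unit-cost operations in an evaluation. -/
def cost : RExp → ℕ
  | lit _ => 1
  | get _ i j => i.cost + j.cost + 1
  | add e f => e.cost + f.cost + 1
  | sub e f => e.cost + f.cost + 1
  | mul e f => e.cost + f.cost + 1
  | div e f => e.cost + f.cost + 1

end RExp

/-- Tests. -/
inductive Test : Type
  | natLe (e f : NExp)
  | realLe (e f : RExp)
  | not (b : Test)
  | and (b c : Test)

namespace Test

def Holds (s : Store) : Test → Prop
  | natLe e f => e.eval s ≤ f.eval s
  | realLe e f => e.eval s ≤ f.eval s
  | not b => ¬ b.Holds s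
  | and b c => b.Holds s ∧ c.Holds s

/-- Number of unit-cost operations in an evaluation. -/
def cost : Test → ℕ
  | natLe e f => e.cost + f.cost + 1
  | realLe e f => e.cost + f.cost + 1
  | not b => b.cost + 1
  | and b c => b.cost + c.cost + 1

end Test

/-- Programs: integer assignment, assignment to an array entry, sequencing, conditional, and
while-loop. -/
inductive Prog : Type
  | skip
  | setNat (r : ℕ) (e : NExp)
  | setReal (a : ℕ) (i j : NExp) (e : RExp)
  | seq (P Q : Prog)
  | cond (b : Test) (P Q : Prog)
  | loop (b : Test) (P : Prog)

namespace Store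

def updNat (s : Store) (r k : ℕ) : Store :=
  { s with nat := fun r' => if r' = r then k else s.nat r' }

noncomputable def updReal (s : Store) (a i j : ℕ) (v : ℝ) : Store :=
  { s with real := fun a' i' j' => if a' = a ∧ i' = i ∧ j' = j then v else s.real a' i' j' }

end Store

/-- `Exec P s t s'`: started in the state `s`, the program `P` halts after exactly `t` steps in
the state `s'`. -/
inductive Exec : Prog → Store → ℕ → Store → Prop
  | skip (s : Store) : Exec Prog.skip s 1 s
  | setNat (r : ℕ) (e : NExp) (s : Store) :
      Exec (Prog.setNat r e) s (e.cost + 1) (s.updNat r (e.eval s))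
  | setReal (a : ℕ) (i j : NExp) (e : RExp) (s : Store) :
      Exec (Prog.setReal a i j e) s (i.cost + j.cost + e.cost + 1)
        (s.updReal a (i.eval s) (j.eval s) (e.eval s))
  | seq {P Q : Prog} {s s₁ s₂ : Store} {t₁ t₂ : ℕ} :
      Exec P s t₁ s₁ → Exec Q s₁ t₂ s₂ → Exec (Prog.seq P Q) s (t₁ + t₂) s₂
  | condTrue {b : Test} {P Q : Prog} {s s₁ : Store} {t : ℕ} :
      b.Holds s → Exec P s t s₁ → Exec (Prog.cond b P Q) s (b.cost + 1 + t) s₁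
  | condFalse {b : Test} {P Q : Prog} {s s₁ : Store} {t : ℕ} :
      ¬ b.Holds s → Exec Q s t s₁ → Exec (Prog.cond b P Q) s (b.cost + 1 + t) s₁
  | loopDone {b : Test} {P : Prog} {s : Store} :
      ¬ b.Holds s → Exec (Prog.loop b P) s (b.cost + 1) s
  | loopStep {b : Test} {P : Prog} {s s₁ s₂ : Store} {t₁ t₂ : ℕ} :
      b.Holds s → Exec P s t₁ s₁ → Exec (Prog.loop b P) s₁ t₂ s₂ →
        Exec (Prog.loop b P) s (b.cost + 1 + t₁ + t₂) s₂

/-- The machine is deterministic. -/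
theorem Exec.unique {P : Prog} {s s₁ s₂ : Store} {t₁ t₂ : ℕ}
    (h₁ : Exec P s t₁ s₁) (h₂ : Exec P s t₂ s₂) : t₁ = t₂ ∧ s₁ = s₂ := by
  induction h₁ generalizing t₂ s₂ with
  | skip s => cases h₂; exact ⟨rfl, rfl⟩
  | setNat r e s => cases h₂; exact ⟨rfl, rfl⟩
  | setReal a i j e s => cases h₂; exact ⟨rfl, rfl⟩
  | seq _ _ ih₁ ih₂ =>
    cases h₂ with
    | seq k₁ k₂ =>
      obtain ⟨rfl, rfl⟩ := ih₁ k₁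
      obtain ⟨rfl, rfl⟩ := ih₂ k₂
      exact ⟨rfl, rfl⟩
  | condTrue hb _ ih =>
    cases h₂ with
    | condTrue _ k => obtain ⟨rfl, rfl⟩ := ih k; exact ⟨rfl, rfl⟩
    | condFalse hb' _ => exact absurd hb hb'
  | condFalse hb _ ih =>
    cases h₂ with
    | condTrue hb' _ => exact absurd hb' hb
    | condFalse _ k => obtain ⟨rfl, rfl⟩ := ih k; exact ⟨rfl, rfl⟩
  | loopDone hb =>
    cases h₂ with
    | loopDone _ => exact ⟨rfl, rfl⟩
    | loopStep hb' _ _ => exact absurd hb' hb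
  | loopStep hb _ _ ih₁ ih₂ =>
    cases h₂ with
    | loopDone hb' => exact absurd hb hb'
    | loopStep _ k₁ k₂ =>
      obtain ⟨rfl, rfl⟩ := ih₁ k₁
      obtain ⟨rfl, rfl⟩ := ih₂ k₂
      exact ⟨rfl, rfl⟩

/-- The initial state on input `(y, ε)`: registers `0` and `1` hold `n` and `d`, array `0` holds
the `n × d` table of coordinates of the points, entry `(0, 0)` of array `1` holds `ε`, and
everything else is zero. -/
noncomputable def inputStore {n d : ℕ} (y : Points n d) (ε : ℝ) : Store where
  nat r := if r = 0 then n else if r = 1 then d else 0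
  real a i j :=
    if a = 0 then (if h : i < n ∧ j < d then y ⟨i, h.1⟩ ⟨j, h.2⟩ else 0)
    else if a = 1 ∧ i = 0 ∧ j = 0 then ε else 0

/-- The output: the first `d` entries of row `0` of array `2`. -/
noncomputable def outputVec (d : ℕ) (s : Store) : RVec d :=
  WithLp.toLp 2 fun j => s.real 2 0 j

end RealRAM

/-- A rule that assigns a vector in `ℝ^d` to every `n`, `d`, every `n` points in `ℝ^d` and
every real parameter `ε`. -/
abbrev Estimator : Type := ∀ n d : ℕ, Points n d → ℝ → RVec d

/-- The estimator is computed by one program, the same for all inputs, which halts on every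
input `(y, ε)` after a number of steps polynomial in `n` and `d`. -/
def Estimator.IsPolyTime (F : Estimator) : Prop :=
  ∃ (P : RealRAM.Prog) (p : Polynomial ℕ), ∀ (n d : ℕ) (y : Points n d) (ε : ℝ),
    ∃ (t : ℕ) (s : RealRAM.Store), RealRAM.Exec P (RealRAM.inputStore y ε) t s ∧
      t ≤ p.eval (n + d) ∧ RealRAM.outputVec d s = F n d y ε

/-!
The algorithm is a filter. It starts from unit weights, scores every point against the weighted
mean, and lowers the weights of the `ε n` points of largest weighted score in proportion to their
scores, until the total weight removed would exceed `2 ε n`.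

As long as some direction carries too much variance, stability forces the corrupted points to
dominate the top scores, so each step removes at least as much weight from them as from the clean
points, and the budget is never exceeded. Every step annihilates the weight of some point; hence
`n` steps exhaust the process, and at some moment the variance is small in every direction. The
unnormalised scatter only decreases with the weights, so it stays small afterwards: the final
weights are good although `σ` and `δ`, and with them the moment of success, are unknown. Small
scatter and stability bound the distance between the means of the remaining weights and of the
clean points.

A real RAM cannot extract eigenvectors. The scores are therefore the values of the quadratic form
of the `2 ^ (n + d)`-th power of the scatter matrix, which takes `n + d` squarings. With a power
this high, replacing the top eigenvalue by the average of the eigenvalues with respect to their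
powers costs only a factor `1 + 1 / n`.
-/

/-! ### Weighted means and directional second moments -/

section WeightedMoments

variable {ι E : Type*} [Fintype ι] [NormedAddCommGroup E] [InnerProductSpace ℝ E]

/-- The mean of the points `y i` with weights `w i`. -/
noncomputable def weightedMean (y : ι → E) (w : ι → ℝ) : E :=
  Finset.univ.centerMass w y

/-- The second moment in direction `v` of the points `y i` with weights `w i`, centered at their
weighted mean. It is not divided by the total weight, so that it is monotone in the weights. -/
noncomputable def weightedScatter (y : ι → E) (w : ι → ℝ) (v : E) : ℝ :=
  ∑ i, w i * inner ℝ v (y i - weightedMean y w) ^ 2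

theorem sum_mul_inner_sub_weightedMean (y : ι → E) {w : ι → ℝ} (hw : ∑ i, w i ≠ 0) (v : E) :
    ∑ i, w i * inner ℝ v (y i - weightedMean y w) = 0 := by
  have hcenter : ∑ i, w i • (y i - weightedMean y w) = 0 := by
    simp only [smul_sub, Finset.sum_sub_distrib, ← Finset.sum_smul]
    rw [weightedMean, Finset.centerMass, smul_smul, mul_inv_cancel₀ hw, one_smul, sub_self]
  simpa only [inner_sum, inner_smul_right, inner_zero_right] using congrArg (inner ℝ v) hcenter

theorem weightedScatter_le_sum (y : ι → E) {w : ι → ℝ} (hw : 0 < ∑ i, w i) (v c : E) :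
    weightedScatter y w v ≤ ∑ i, w i * inner ℝ v (y i - c) ^ 2 := by
  set m := weightedMean y w with hm
  have hexpand (i : ι) : w i * inner ℝ v (y i - c) ^ 2 = w i * inner ℝ v (y i - m) ^ 2 +
      2 * inner ℝ v (m - c) * (w i * inner ℝ v (y i - m)) + w i * inner ℝ v (m - c) ^ 2 := by
    rw [← sub_add_sub_cancel (y i) m c, inner_add_right]
    ring
  have hsq : 0 ≤ (∑ i, w i) * inner ℝ v (m - c) ^ 2 := by positivity
  simp only [hexpand, Finset.sum_add_distrib, ← Finset.mul_sum, ← Finset.sum_mul]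
  rw [sum_mul_inner_sub_weightedMean y hw.ne' v, weightedScatter, ← hm]
  linarith

theorem weightedScatter_mono (y : ι → E) {w w' : ι → ℝ} (hw : 0 < ∑ i, w i)
    (hle : ∀ i, w i ≤ w' i) (v : E) : weightedScatter y w v ≤ weightedScatter y w' v :=
  (weightedScatter_le_sum y hw v (weightedMean y w')).trans
    (Finset.sum_le_sum fun i _ => mul_le_mul_of_nonneg_right (hle i) (sq_nonneg _))

end WeightedMoments

theorem sq_sum_mul_le_sum_mul_sum_mul_sq {ι : Type*} (t : Finset ι) {u : ι → ℝ} (f : ι → ℝ)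
    (hu : ∀ i, 0 ≤ u i) :
    (∑ i ∈ t, u i * f i) ^ 2 ≤ (∑ i ∈ t, u i) * ∑ i ∈ t, u i * f i ^ 2 :=
  Finset.sum_sq_le_sum_mul_sum_of_sq_le_mul t (fun i _ => hu i)
    (fun i _ => mul_nonneg (hu i) (sq_nonneg _)) fun _ _ => le_of_eq (by ring)

theorem two_mul_sub_sq_mul_le_sq_div {t S W W₀ : ℝ} (hW₀ : 0 < W₀) (hW : W₀ ≤ W) :
    2 * t * S - t ^ 2 * W ≤ S ^ 2 / W₀ := by
  rw [le_div_iff₀ hW₀]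
  nlinarith [sq_nonneg (t * W₀ - S), mul_le_mul_of_nonneg_left hW (mul_nonneg (sq_nonneg t) hW₀.le)]

theorem norm_sq_le_of_forall_inner_sq_le {E : Type*} [NormedAddCommGroup E]
    [InnerProductSpace ℝ E] {z : E} {c : ℝ} (hc : 0 ≤ c)
    (h : ∀ v : E, ‖v‖ = 1 → inner ℝ v z ^ 2 ≤ c) : ‖z‖ ^ 2 ≤ c := by
  rcases eq_or_ne z 0 with rfl | hz
  · simpa using hc
  · have hz' : ‖z‖ ≠ 0 := norm_ne_zero_iff.2 hz
    have hinner : inner ℝ (‖z‖⁻¹ • z) z = ‖z‖ := by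
      rw [real_inner_smul_left, real_inner_self_eq_norm_sq, sq, inv_mul_cancel_left₀ hz']
    simpa only [hinner] using h (‖z‖⁻¹ • z) (norm_smul_inv_norm (𝕜 := ℝ) hz)

/-! ### The error of a weighted mean -/

/-- The weights `w` lie in `[0, 1]` and at most mass `2 τ` has been removed from them. -/
structure IsNearlyFull {ι : Type*} [Fintype ι] (τ : ℝ) (w : ι → ℝ) : Prop where
  nonneg : ∀ i, 0 ≤ w i
  le_one : ∀ i, w i ≤ 1
  sum_one_sub_le : ∑ i, (1 - w i) ≤ 2 * τ

section Deficit

variable {ι : Type*} [DecidableEq ι] {B : Finset ι} {w : ι → ℝ}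

/-- The weight that the uncorrupted points lack: all of it on `B`, and `1 - w i` elsewhere. -/
noncomputable def deficit (B : Finset ι) (w : ι → ℝ) (i : ι) : ℝ :=
  if i ∈ B then 1 else 1 - w i

theorem sum_compl_mul_eq_sum_sub_sum_deficit_mul [Fintype ι] (B : Finset ι) (w f : ι → ℝ) :
    ∑ i ∈ Bᶜ, w i * f i = ∑ i, f i - ∑ i, deficit B w i * f i := by
  rw [← Finset.sum_sub_distrib, Finset.compl_eq_univ_sdiff, Finset.sdiff_eq_filter,
    Finset.sum_filter]
  refine Finset.sum_congr rfl fun i _ => ?_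
  by_cases hi : i ∈ B
  · simp [deficit, hi]
  · simp only [deficit, hi, not_false_eq_true, if_true, if_false]
    ring

theorem deficit_nonneg (hw : ∀ i, w i ≤ 1) (i : ι) : 0 ≤ deficit B w i := by
  unfold deficit
  split_ifs
  exacts [zero_le_one, sub_nonneg.2 (hw i)]

theorem deficit_le_one (hw : ∀ i, 0 ≤ w i) (i : ι) : deficit B w i ≤ 1 := by
  unfold deficit
  split_ifs
  exacts [le_rfl, sub_le_self 1 (hw i)]

end Deficit

/-- The sample `y` arises from `x` by replacing the points in `B`, a fraction at most `ε` of all.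
In every direction the second moment of `x` about its mean `μ` is `s ± Δ`, and any (fractional)
selection of `3 ε` of the points contributes at most `3 Δ` to it. -/
structure IsContaminated {ι E : Type*} [Fintype ι] [NormedAddCommGroup E] [InnerProductSpace ℝ E]
    (x y : ι → E) (B : Finset ι) (μ : E) (ε s Δ : ℝ) : Prop where
  agree : ∀ i ∉ B, y i = x i
  card_le : (B.card : ℝ) ≤ ε * Fintype.card ι
  centered : ∑ i, (x i - μ) = 0
  eps_le : ε ≤ 1 / 2000
  one_le : 1 ≤ ε * Fintype.card ι
  s_nonneg : 0 ≤ s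
  s_mul_le : s * ε ≤ Δ
  moment_ge : ∀ v, ‖v‖ = 1 → Fintype.card ι * (s - Δ) ≤ ∑ i, inner ℝ v (x i - μ) ^ 2
  moment_le : ∀ v, ‖v‖ = 1 → ∑ i, inner ℝ v (x i - μ) ^ 2 ≤ Fintype.card ι * (s + Δ)
  tail_le : ∀ v, ‖v‖ = 1 → ∀ u : ι → ℝ, (∀ i, 0 ≤ u i) → (∀ i, u i ≤ 1) →
    ∑ i, u i ≤ 3 * (ε * Fintype.card ι) →
      ∑ i, u i * inner ℝ v (x i - μ) ^ 2 ≤ 3 * Fintype.card ι * Δ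

namespace IsContaminated

section Parameters

variable {ι E : Type*} [Fintype ι] [NormedAddCommGroup E] [InnerProductSpace ℝ E]
  {x y : ι → E} {B : Finset ι} {μ : E} {ε s Δ : ℝ}

theorem card_pos (h : IsContaminated x y B μ ε s Δ) : (0 : ℝ) < Fintype.card ι := by
  refine (Nat.cast_nonneg _).lt_of_ne fun hzero => ?_
  have := h.one_le
  rw [← hzero] at this
  linarith

theorem eps_pos (h : IsContaminated x y B μ ε s Δ) : 0 < ε :=
  pos_of_mul_pos_left (one_pos.trans_le h.one_le) h.card_pos.le

theorem delta_nonneg (h : IsContaminated x y B μ ε s Δ) : 0 ≤ Δ :=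
  (mul_nonneg h.s_nonneg h.eps_pos.le).trans h.s_mul_le

theorem sum_weight_le (h : IsContaminated x y B μ ε s Δ) {w : ι → ℝ}
    (hw : ∀ i, w i ≤ 1) :
    ∑ i ∈ B, w i ≤ ε * Fintype.card ι :=
  (Finset.sum_le_card_nsmul B w 1 fun i _ => hw i).trans
    (by rw [nsmul_eq_mul, mul_one]; exact h.card_le)

end Parameters

section Complement

variable {ι E : Type*} [Fintype ι] [DecidableEq ι] [NormedAddCommGroup E] [InnerProductSpace ℝ E]
  {x y : ι → E} {B : Finset ι} {μ : E} {ε s Δ : ℝ} {w : ι → ℝ} {v : E}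

theorem sum_deficit_le (h : IsContaminated x y B μ ε s Δ)
    (hw : IsNearlyFull (ε * Fintype.card ι) w) :
    ∑ i, deficit B w i ≤ 3 * (ε * Fintype.card ι) := by
  have hpointwise (i : ι) : deficit B w i ≤ (1 - w i) + if i ∈ B then 1 else 0 := by
    have := hw.le_one i
    unfold deficit
    split_ifs <;> linarith
  have hsum := Finset.sum_le_sum fun i (_ : i ∈ Finset.univ) => hpointwise i
  rw [Finset.sum_add_distrib, Finset.sum_boole, Finset.filter_univ_mem] at hsum
  linarith [h.card_le, hw.sum_one_sub_le]

theorem half_card_le_sum_compl (h : IsContaminated x y B μ ε s Δ)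
    (hw : IsNearlyFull (ε * Fintype.card ι) w) : (Fintype.card ι : ℝ) / 2 ≤ ∑ i ∈ Bᶜ, w i := by
  have hsplit := sum_compl_mul_eq_sum_sub_sum_deficit_mul B w 1
  simp only [Pi.one_apply, mul_one, Finset.sum_const, Finset.card_univ, nsmul_eq_mul] at hsplit
  nlinarith [h.sum_deficit_le hw, h.eps_le, h.card_pos]

theorem sum_deficit_mul_sq_le (h : IsContaminated x y B μ ε s Δ)
    (hw : IsNearlyFull (ε * Fintype.card ι) w) (hv : ‖v‖ = 1) :
    ∑ i, deficit B w i * inner ℝ v (x i - μ) ^ 2 ≤ 3 * Fintype.card ι * Δ :=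
  h.tail_le v hv _ (deficit_nonneg hw.le_one) (deficit_le_one hw.nonneg) (h.sum_deficit_le hw)

theorem le_sum_compl_mul_sq (h : IsContaminated x y B μ ε s Δ)
    (hw : IsNearlyFull (ε * Fintype.card ι) w) (hv : ‖v‖ = 1) :
    Fintype.card ι * (s - 4 * Δ) ≤ ∑ i ∈ Bᶜ, w i * inner ℝ v (x i - μ) ^ 2 := by
  rw [sum_compl_mul_eq_sum_sub_sum_deficit_mul]
  linarith [h.moment_ge v hv, h.sum_deficit_mul_sq_le hw hv]

theorem sum_compl_mul_sq_le (h : IsContaminated x y B μ ε s Δ) (hw : ∀ i, w i ≤ 1)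
    (hv : ‖v‖ = 1) :
    ∑ i ∈ Bᶜ, w i * inner ℝ v (x i - μ) ^ 2 ≤ Fintype.card ι * (s + Δ) := by
  rw [sum_compl_mul_eq_sum_sub_sum_deficit_mul]
  have : 0 ≤ ∑ i, deficit B w i * inner ℝ v (x i - μ) ^ 2 :=
    Finset.sum_nonneg fun i _ => mul_nonneg (deficit_nonneg hw i) (sq_nonneg _)
  linarith [h.moment_le v hv]

theorem sq_sum_compl_mul_inner_le (h : IsContaminated x y B μ ε s Δ)
    (hw : IsNearlyFull (ε * Fintype.card ι) w) (hv : ‖v‖ = 1) :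
    (∑ i ∈ Bᶜ, w i * inner ℝ v (x i - μ)) ^ 2 ≤ 9 * ε * Fintype.card ι ^ 2 * Δ := by
  have hcentered : ∑ i, inner ℝ v (x i - μ) = 0 := by
    rw [← inner_sum, h.centered, inner_zero_right]
  rw [sum_compl_mul_eq_sum_sub_sum_deficit_mul, hcentered, zero_sub, neg_sq]
  have hdeficit := deficit_nonneg (B := B) hw.le_one
  calc (∑ i, deficit B w i * inner ℝ v (x i - μ)) ^ 2
      ≤ (∑ i, deficit B w i) * ∑ i, deficit B w i * inner ℝ v (x i - μ) ^ 2 :=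
        sq_sum_mul_le_sum_mul_sum_mul_sq _ _ hdeficit
    _ ≤ (3 * (ε * Fintype.card ι)) * (3 * Fintype.card ι * Δ) :=
        mul_le_mul (h.sum_deficit_le hw) (h.sum_deficit_mul_sq_le hw hv)
          (Finset.sum_nonneg fun i _ => mul_nonneg (hdeficit i) (sq_nonneg _))
          (by linarith [h.one_le])
    _ = 9 * ε * Fintype.card ι ^ 2 * Δ := by ring

theorem inner_sub_eq_of_mem_compl (h : IsContaminated x y B μ ε s Δ) (v c : E) {i : ι}
    (hi : i ∈ Bᶜ) : inner ℝ v (y i - c) = inner ℝ v (x i - μ) - inner ℝ v (c - μ) := by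
  rw [h.agree i (Finset.mem_compl.1 hi), ← inner_sub_right, sub_sub_sub_cancel_right]

theorem sum_compl_mul_inner_sub (h : IsContaminated x y B μ ε s Δ) (w : ι → ℝ) (v c : E) :
    ∑ i ∈ Bᶜ, w i * inner ℝ v (y i - c) =
      ∑ i ∈ Bᶜ, w i * inner ℝ v (x i - μ) - inner ℝ v (c - μ) * ∑ i ∈ Bᶜ, w i := by
  rw [Finset.mul_sum, ← Finset.sum_sub_distrib]
  refine Finset.sum_congr rfl fun i hi => ?_
  rw [h.inner_sub_eq_of_mem_compl v c hi]
  ring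

theorem sum_compl_mul_inner_sub_sq (h : IsContaminated x y B μ ε s Δ) (w : ι → ℝ) (v c : E) :
    ∑ i ∈ Bᶜ, w i * inner ℝ v (y i - c) ^ 2 =
      ∑ i ∈ Bᶜ, w i * inner ℝ v (x i - μ) ^ 2 -
        2 * inner ℝ v (c - μ) * ∑ i ∈ Bᶜ, w i * inner ℝ v (x i - μ) +
        inner ℝ v (c - μ) ^ 2 * ∑ i ∈ Bᶜ, w i := by
  rw [Finset.mul_sum, Finset.mul_sum, ← Finset.sum_sub_distrib, ← Finset.sum_add_distrib]
  refine Finset.sum_congr rfl fun i hi => ?_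
  rw [h.inner_sub_eq_of_mem_compl v c hi]
  ring

theorem inner_weightedMean_sub_mul_sum_compl (h : IsContaminated x y B μ ε s Δ)
    (hw : ∑ i, w i ≠ 0) (v : E) :
    inner ℝ v (weightedMean y w - μ) * ∑ i ∈ Bᶜ, w i =
      ∑ i ∈ Bᶜ, w i * inner ℝ v (x i - μ) +
        ∑ i ∈ B, w i * inner ℝ v (y i - weightedMean y w) := by
  have hzero := sum_mul_inner_sub_weightedMean y hw v
  rw [← Finset.sum_add_sum_compl B, h.sum_compl_mul_inner_sub] at hzero
  linarith

end Complement

variable {ι E : Type*} [Fintype ι] [NormedAddCommGroup E] [InnerProductSpace ℝ E]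
  {x y : ι → E} {B : Finset ι} {μ : E} {ε s Δ : ℝ} {w : ι → ℝ} {v : E}

theorem half_card_le_sum (h : IsContaminated x y B μ ε s Δ)
    (hw : IsNearlyFull (ε * Fintype.card ι) w) : (Fintype.card ι : ℝ) / 2 ≤ ∑ i, w i := by
  classical
  exact (h.half_card_le_sum_compl hw).trans
    (Finset.sum_le_sum_of_subset_of_nonneg (Finset.subset_univ _) fun i _ _ => hw.nonneg i)

theorem sum_weight_pos (h : IsContaminated x y B μ ε s Δ)
    (hw : IsNearlyFull (ε * Fintype.card ι) w) : 0 < ∑ i, w i :=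
  (half_pos h.card_pos).trans_le (h.half_card_le_sum hw)

theorem sum_mul_sq_le_of_weightedScatter_le (h : IsContaminated x y B μ ε s Δ)
    (hw : IsNearlyFull (ε * Fintype.card ι) w) (hv : ‖v‖ = 1) {Λ : ℝ}
    (hscatter : weightedScatter y w v ≤ Fintype.card ι * (s + Λ)) :
    ∑ i ∈ B, w i * inner ℝ v (y i - weightedMean y w) ^ 2 ≤ Fintype.card ι * (Λ + 5 * Δ) := by
  classical
  rw [weightedScatter, ← Finset.sum_add_sum_compl B, h.sum_compl_mul_inner_sub_sq] at hscatter
  have hn := h.card_pos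
  set S := ∑ i ∈ Bᶜ, w i * inner ℝ v (x i - μ)
  have hcross := two_mul_sub_sq_mul_le_sq_div (t := inner ℝ v (weightedMean y w - μ)) (S := S)
    (half_pos hn) (h.half_card_le_sum_compl hw)
  have hS : S ^ 2 / (Fintype.card ι / 2) ≤ Fintype.card ι * Δ := by
    rw [div_le_iff₀ (half_pos hn)]
    have hsmall : 18 * ε * (Fintype.card ι ^ 2 * Δ) ≤ 1 * (Fintype.card ι ^ 2 * Δ) :=
      mul_le_mul_of_nonneg_right (by linarith [h.eps_le])
        (mul_nonneg (sq_nonneg _) h.delta_nonneg)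
    linarith [h.sq_sum_compl_mul_inner_le hw hv]
  linarith [h.le_sum_compl_mul_sq hw hv]

theorem sq_sum_mul_inner_le_of_weightedScatter_le (h : IsContaminated x y B μ ε s Δ)
    (hw : IsNearlyFull (ε * Fintype.card ι) w) (hv : ‖v‖ = 1) {Λ : ℝ}
    (hscatter : weightedScatter y w v ≤ Fintype.card ι * (s + Λ)) :
    (∑ i ∈ B, w i * inner ℝ v (y i - weightedMean y w)) ^ 2 ≤
      ε * Fintype.card ι ^ 2 * (Λ + 5 * Δ) :=
  calc (∑ i ∈ B, w i * inner ℝ v (y i - weightedMean y w)) ^ 2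
      ≤ (∑ i ∈ B, w i) * ∑ i ∈ B, w i * inner ℝ v (y i - weightedMean y w) ^ 2 :=
        sq_sum_mul_le_sum_mul_sum_mul_sq _ _ hw.nonneg
    _ ≤ (ε * Fintype.card ι) * (Fintype.card ι * (Λ + 5 * Δ)) :=
        mul_le_mul (h.sum_weight_le hw.le_one)
          (h.sum_mul_sq_le_of_weightedScatter_le hw hv hscatter)
          (Finset.sum_nonneg fun i _ => mul_nonneg (hw.nonneg i) (sq_nonneg _))
          (zero_le_one.trans h.one_le)
    _ = ε * Fintype.card ι ^ 2 * (Λ + 5 * Δ) := by ring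

theorem inner_weightedMean_sub_sq_le (h : IsContaminated x y B μ ε s Δ)
    (hw : IsNearlyFull (ε * Fintype.card ι) w) (hv : ‖v‖ = 1) {Λ : ℝ}
    (hscatter : weightedScatter y w v ≤ Fintype.card ι * (s + Λ)) :
    inner ℝ v (weightedMean y w - μ) ^ 2 ≤ ε * (112 * Δ + 8 * Λ) := by
  classical
  set t := inner ℝ v (weightedMean y w - μ)
  set S := ∑ i ∈ Bᶜ, w i * inner ℝ v (x i - μ)
  set b := ∑ i ∈ B, w i * inner ℝ v (y i - weightedMean y w)
  have hbalance : t * ∑ i ∈ Bᶜ, w i = S + b :=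
    h.inner_weightedMean_sub_mul_sum_compl (h.sum_weight_pos hw).ne' v
  have hgood : S ^ 2 ≤ 9 * ε * Fintype.card ι ^ 2 * Δ := h.sq_sum_compl_mul_inner_le hw hv
  have hbad : b ^ 2 ≤ ε * Fintype.card ι ^ 2 * (Λ + 5 * Δ) :=
    h.sq_sum_mul_inner_le_of_weightedScatter_le hw hv hscatter
  have hn := h.card_pos
  refine le_of_mul_le_mul_left (a := (Fintype.card ι / 2 : ℝ) ^ 2) ?_ (by positivity)
  calc (Fintype.card ι / 2 : ℝ) ^ 2 * t ^ 2 ≤ (∑ i ∈ Bᶜ, w i) ^ 2 * t ^ 2 :=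
        mul_le_mul_of_nonneg_right
          (pow_le_pow_left₀ (by positivity) (h.half_card_le_sum_compl hw) 2) (sq_nonneg t)
    _ = (S + b) ^ 2 := by rw [← hbalance]; ring
    _ ≤ 2 * (S ^ 2 + b ^ 2) := add_sq_le
    _ ≤ (Fintype.card ι / 2 : ℝ) ^ 2 * (ε * (112 * Δ + 8 * Λ)) := by linarith

theorem norm_weightedMean_sub_sq_le (h : IsContaminated x y B μ ε s Δ)
    (hw : IsNearlyFull (ε * Fintype.card ι) w) {Λ : ℝ} (hΛ : 0 ≤ Λ)
    (hscatter : ∀ v, ‖v‖ = 1 → weightedScatter y w v ≤ Fintype.card ι * (s + Λ)) :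
    ‖weightedMean y w - μ‖ ^ 2 ≤ ε * (112 * Δ + 8 * Λ) :=
  norm_sq_le_of_forall_inner_sq_le
    (mul_nonneg h.eps_pos.le (by linarith [h.delta_nonneg])) fun v hv =>
      h.inner_weightedMean_sub_sq_le hw hv (hscatter v hv)

end IsContaminated

/-! ### Largest entries -/

section Rank

variable {ι : Type*}

/-- The key by which indices are sorted when the entries of `a` are listed in decreasing order,
ties being broken in favour of the smaller index. -/
def descendingKey (a : ι → ℝ) (i : ι) : ℝᵒᵈ ×ₗ ι :=
  toLex (OrderDual.toDual (a i), i)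

theorem descendingKey_injective (a : ι → ℝ) : Function.Injective (descendingKey a) :=
  fun _ _ h => (Prod.ext_iff.1 (toLex_inj.1 h)).2

variable [LinearOrder ι]

theorem descendingKey_lt_iff {a : ι → ℝ} {i j : ι} :
    descendingKey a j < descendingKey a i ↔ a i < a j ∨ a i = a j ∧ j < i := by
  rw [descendingKey, descendingKey, Prod.Lex.toLex_lt_toLex, OrderDual.toDual_lt_toDual,
    OrderDual.toDual_inj, eq_comm]

variable [Fintype ι]

/-- The number of indices listed before `i`. -/
noncomputable def descendingRank (a : ι → ℝ) (i : ι) : ℕ :=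
  (Finset.univ.filter fun j => descendingKey a j < descendingKey a i).card

theorem descendingRank_lt_descendingRank_iff {a : ι → ℝ} {i j : ι} :
    descendingRank a j < descendingRank a i ↔ descendingKey a j < descendingKey a i := by
  have hmono {k l : ι} (hkl : descendingKey a k ≤ descendingKey a l) :
      descendingRank a k ≤ descendingRank a l :=
    Finset.card_le_card (Finset.monotone_filter_right _ fun _ _ h => h.trans_le hkl)
  refine ⟨fun h => not_le.1 fun hle => h.not_ge (hmono hle), fun h => ?_⟩
  refine Finset.card_lt_card ((Finset.ssubset_iff_of_subset ?_).2 ⟨j, ?_, ?_⟩)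
  · exact Finset.monotone_filter_right _ fun _ _ hk => hk.trans h
  · simpa using h
  · simp

theorem descendingRank_injective (a : ι → ℝ) : Function.Injective (descendingRank a) :=
  fun _ _ hij => descendingKey_injective a <| le_antisymm
    (not_lt.1 fun h => (descendingRank_lt_descendingRank_iff.2 h).ne' hij)
    (not_lt.1 fun h => (descendingRank_lt_descendingRank_iff.2 h).ne hij)

theorem descendingRank_lt_card (a : ι → ℝ) (i : ι) : descendingRank a i < Fintype.card ι :=
  Finset.card_lt_univ_of_notMem (x := i) (by simp)

theorem image_descendingRank_univ (a : ι → ℝ) :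
    Finset.univ.image (descendingRank a) = Finset.range (Fintype.card ι) := by
  refine Finset.eq_of_subset_of_card_le (fun k hk => ?_) ?_
  · obtain ⟨i, -, rfl⟩ := Finset.mem_image.1 hk
    exact Finset.mem_range.2 (descendingRank_lt_card a i)
  · rw [Finset.card_image_of_injective _ (descendingRank_injective a), Finset.card_range,
      Finset.card_univ]

/-- The `⌊τ⌋` indices that are listed first. -/
noncomputable def topSet (a : ι → ℝ) (τ : ℝ) : Finset ι :=
  {i | (descendingRank a i : ℝ) + 1 ≤ τ}

variable {a : ι → ℝ} {τ : ℝ}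

theorem mem_topSet {i : ι} : i ∈ topSet a τ ↔ (descendingRank a i : ℝ) + 1 ≤ τ := by
  simp [topSet]

theorem card_topSet (hτ : τ ≤ Fintype.card ι) : (topSet a τ).card = ⌊τ⌋₊ := by
  have himage : (topSet a τ).image (descendingRank a) = Finset.range ⌊τ⌋₊ := by
    ext k
    simp only [Finset.mem_image, mem_topSet, Finset.mem_range]
    constructor
    · rintro ⟨i, hi, rfl⟩
      exact Nat.le_floor (by exact_mod_cast hi)
    · intro hk
      have hk' : k ∈ Finset.univ.image (descendingRank a) := by
        rw [image_descendingRank_univ, Finset.mem_range]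
        exact hk.trans_le (Nat.floor_le_of_le hτ)
      obtain ⟨i, -, rfl⟩ := Finset.mem_image.1 hk'
      exact ⟨i, by exact_mod_cast (Nat.le_floor_iff' (Nat.succ_ne_zero _)).1 hk, rfl⟩
  rw [← Finset.card_range ⌊τ⌋₊, ← himage,
    Finset.card_image_of_injective _ (descendingRank_injective a)]

theorem topSet_eq_empty (hτ : τ < 1) : topSet a τ = ∅ :=
  Finset.filter_eq_empty_iff.2 fun i _ => not_le.2 (hτ.trans_le (by simp))

theorem apply_le_of_mem_topSet {i j : ι} (hi : i ∈ topSet a τ) (hj : j ∉ topSet a τ) :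
    a j ≤ a i := by
  rw [mem_topSet] at hi hj
  by_contra! h
  have hrank : (descendingRank a j : ℝ) < descendingRank a i := by
    exact_mod_cast descendingRank_lt_descendingRank_iff.2 (descendingKey_lt_iff.2 (Or.inl h))
  linarith

theorem sum_mul_le_sum_topSet {u : ι → ℝ} (ha : ∀ i, 0 ≤ a i) (hu : ∀ i, 0 ≤ u i)
    (hu_le : ∀ i, u i ≤ 1) (hsum : ∑ i, u i ≤ (topSet a τ).card) :
    ∑ i, u i * a i ≤ ∑ i ∈ topSet a τ, a i := by
  rcases (topSet a τ).eq_empty_or_nonempty with hempty | hne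
  · rw [hempty, Finset.card_empty, Nat.cast_zero] at hsum
    have hzero := (Finset.sum_eq_zero_iff_of_nonneg fun i _ => hu i).1
      (le_antisymm hsum (Finset.sum_nonneg fun i _ => hu i))
    rw [hempty, Finset.sum_empty, Finset.sum_eq_zero fun i hi => by rw [hzero i hi, zero_mul]]
  · obtain ⟨m, hm, hmin⟩ := Finset.exists_min_image _ a hne
    have hin : ∑ i ∈ topSet a τ, u i * (a i - a m) ≤ ∑ i ∈ topSet a τ, (a i - a m) :=
      Finset.sum_le_sum fun i hi => mul_le_of_le_one_left (sub_nonneg.2 (hmin i hi)) (hu_le i)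
    have hout : ∑ i ∈ (topSet a τ)ᶜ, u i * (a i - a m) ≤ 0 :=
      Finset.sum_nonpos fun i hi => mul_nonpos_of_nonneg_of_nonpos (hu i)
        (sub_nonpos.2 (apply_le_of_mem_topSet hm (Finset.mem_compl.1 hi)))
    have hshift : ∑ i, u i * (a i - a m) ≤ ∑ i ∈ topSet a τ, (a i - a m) := by
      rw [← Finset.sum_add_sum_compl (topSet a τ)]
      linarith
    simp only [mul_sub, Finset.sum_sub_distrib, ← Finset.sum_mul, Finset.sum_const,
      nsmul_eq_mul] at hshift
    linarith [mul_le_mul_of_nonneg_right hsum (ha m)]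

theorem sum_le_sum_topSet {B : Finset ι} (ha : ∀ i, 0 ≤ a i)
    (hcard : B.card ≤ (topSet a τ).card) : ∑ i ∈ B, a i ≤ ∑ i ∈ topSet a τ, a i := by
  have hsum := sum_mul_le_sum_topSet (u := fun i => if i ∈ B then 1 else 0) (τ := τ) ha
    (fun i => by split_ifs <;> norm_num) (fun i => by split_ifs <;> norm_num)
    (by simpa using hcard)
  simpa only [ite_mul, one_mul, zero_mul, Finset.sum_ite_mem, Finset.univ_inter] using hsum

end Rank

/-! ### Powers of the scatter matrix -/

section Spectral

variable {κ : Type*} [Fintype κ]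

theorem mul_max_mul_sum_pow_le {N m : ℕ} (hm : N * Fintype.card κ ≤ m) {a : κ → ℝ}
    (ha : ∀ l, 0 ≤ a l) {l₀ : κ} (hmax : ∀ l, a l ≤ a l₀) :
    N * (a l₀ * ∑ l, a l ^ m) ≤ (N + 1) * ∑ l, a l ^ (m + 1) := by
  have hsingle : a l₀ ^ (m + 1) ≤ ∑ l, a l ^ (m + 1) :=
    Finset.single_le_sum (f := fun l => a l ^ (m + 1)) (fun l _ => pow_nonneg (ha l) _)
      (Finset.mem_univ l₀)
  have hterm (l : κ) :
      (Fintype.card κ : ℝ) * (N * (a l ^ m * (a l₀ - a l))) ≤ a l₀ ^ (m + 1) := by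
    have hbernoulli := pow_add_mul_le_add_pow (b := a l₀ - a l) (ha l)
      (by linarith [ha l, ha l₀]) (m + 1)
    rw [Nat.add_sub_cancel, add_sub_cancel, Nat.cast_succ] at hbernoulli
    have hgap : 0 ≤ a l ^ m * (a l₀ - a l) :=
      mul_nonneg (pow_nonneg (ha l) m) (sub_nonneg.2 (hmax l))
    have hm' : (N * Fintype.card κ : ℝ) ≤ m := by exact_mod_cast hm
    linarith [mul_le_mul_of_nonneg_right hm' hgap, pow_nonneg (ha l) (m + 1)]
  have hsum := Finset.sum_le_card_nsmul Finset.univ _ _ fun l _ => hterm l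
  rw [← Finset.mul_sum, ← Finset.mul_sum, Finset.card_univ, nsmul_eq_mul] at hsum
  have hcard : (0 : ℝ) < Fintype.card κ := by exact_mod_cast Fintype.card_pos_iff.2 ⟨l₀⟩
  have hdiff : N * ∑ l, a l ^ m * (a l₀ - a l) ≤ a l₀ ^ (m + 1) :=
    le_of_mul_le_mul_left hsum hcard
  simp only [mul_sub, Finset.sum_sub_distrib, ← Finset.sum_mul, ← pow_succ] at hdiff
  linarith

theorem mul_le_two_pow_add (a b : ℕ) : a * b ≤ 2 ^ (a + b) := by
  rw [pow_add]
  exact Nat.mul_le_mul Nat.lt_two_pow_self.le Nat.lt_two_pow_self.le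

theorem nonempty_of_norm_eq_one {v : EuclideanSpace ℝ κ} (hv : ‖v‖ = 1) : Nonempty κ := by
  by_contra hempty
  rw [not_nonempty_iff] at hempty
  rw [Subsingleton.elim v 0, norm_zero] at hv
  exact zero_ne_one hv

open Matrix

theorem dotProduct_vecMulVec_self_mulVec (v z : EuclideanSpace ℝ κ) :
    v.ofLp ⬝ᵥ (vecMulVec z.ofLp z.ofLp *ᵥ v.ofLp) = inner ℝ v z ^ 2 := by
  rw [vecMulVec_mulVec]
  simp only [EuclideanSpace.inner_eq_star_dotProduct, star_trivial, op_smul_eq_smul,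
    dotProduct_smul, smul_eq_mul]
  rw [dotProduct_comm v.ofLp, sq]

variable {ι : Type*} [Fintype ι] {y : ι → EuclideanSpace ℝ κ} {w : ι → ℝ}

/-- The weighted covariance matrix of the points `y i`, not divided by the total weight; its
quadratic form is `weightedScatter`. -/
noncomputable def scatterMatrix (y : ι → EuclideanSpace ℝ κ) (w : ι → ℝ) : Matrix κ κ ℝ :=
  ∑ i, w i • vecMulVec (y i - weightedMean y w).ofLp (y i - weightedMean y w).ofLp

theorem dotProduct_scatterMatrix_mulVec (y : ι → EuclideanSpace ℝ κ) (w : ι → ℝ)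
    (v : EuclideanSpace ℝ κ) :
    v.ofLp ⬝ᵥ (scatterMatrix y w *ᵥ v.ofLp) = weightedScatter y w v := by
  rw [scatterMatrix, sum_mulVec, dotProduct_sum, weightedScatter]
  exact Finset.sum_congr rfl fun i _ => by
    rw [smul_mulVec, dotProduct_smul, dotProduct_vecMulVec_self_mulVec, smul_eq_mul]

theorem posSemidef_scatterMatrix (y : ι → EuclideanSpace ℝ κ) (hw : ∀ i, 0 ≤ w i) :
    (scatterMatrix y w).PosSemidef :=
  posSemidef_sum _ fun i _ => (posSemidef_vecMulVec_self_star _).smul (hw i)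

variable [DecidableEq κ]

theorem pow_mulVec_eigenvectorBasis {A : Matrix κ κ ℝ} (hA : A.IsHermitian) (m : ℕ) (l : κ) :
    A ^ m *ᵥ (hA.eigenvectorBasis l).ofLp =
      hA.eigenvalues l ^ m • (hA.eigenvectorBasis l).ofLp := by
  induction m with
  | zero => simp
  | succ m ih =>
    rw [pow_succ, ← mulVec_mulVec, hA.mulVec_eigenvectorBasis, mulVec_smul, ih, smul_smul,
      pow_succ']

theorem dotProduct_pow_mulVec_eq_sum {A : Matrix κ κ ℝ} (hA : A.IsHermitian) (m : ℕ)
    (z : EuclideanSpace ℝ κ) :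
    z.ofLp ⬝ᵥ (A ^ m *ᵥ z.ofLp) =
      ∑ l, hA.eigenvalues l ^ m * inner ℝ (hA.eigenvectorBasis l) z ^ 2 := by
  have hz : z.ofLp = ∑ l, inner ℝ (hA.eigenvectorBasis l) z • (hA.eigenvectorBasis l).ofLp := by
    conv_lhs => rw [← hA.eigenvectorBasis.sum_repr' z]
    simp
  have hinner (l : κ) : z.ofLp ⬝ᵥ (hA.eigenvectorBasis l).ofLp =
      inner ℝ (hA.eigenvectorBasis l) z := by
    simp [EuclideanSpace.inner_eq_star_dotProduct]
  conv_lhs => rw [hz, mulVec_sum, ← hz, dotProduct_sum]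
  refine Finset.sum_congr rfl fun l _ => ?_
  rw [mulVec_smul, pow_mulVec_eigenvectorBasis, dotProduct_smul, dotProduct_smul, hinner]
  simp only [smul_eq_mul]
  ring

/-- The outlyingness of the point `y i`: the quadratic form at `y i - weightedMean y w` of a high
power of the scatter matrix. The exponent is a power of two, to be reached by squaring, and is at
least the product of the number of points and the dimension. -/
noncomputable def outlierScore (y : ι → EuclideanSpace ℝ κ) (w : ι → ℝ) (i : ι) : ℝ :=
  (y i - weightedMean y w).ofLp ⬝ᵥ
    (scatterMatrix y w ^ 2 ^ (Fintype.card ι + Fintype.card κ) *ᵥ (y i - weightedMean y w).ofLp)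

variable (hA : (scatterMatrix y w).IsHermitian)

theorem weightedScatter_eq_sum_eigenvalues (v : EuclideanSpace ℝ κ) :
    weightedScatter y w v = ∑ l, hA.eigenvalues l * inner ℝ (hA.eigenvectorBasis l) v ^ 2 := by
  simpa only [pow_one, dotProduct_scatterMatrix_mulVec] using dotProduct_pow_mulVec_eq_sum hA 1 v

theorem weightedScatter_eigenvectorBasis (l : κ) :
    weightedScatter y w (hA.eigenvectorBasis l) = hA.eigenvalues l := by
  rw [weightedScatter_eq_sum_eigenvalues hA]
  simp [OrthonormalBasis.inner_eq_ite]

theorem weightedScatter_le_eigenvalue {l₀ : κ}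
    (hmax : ∀ l, hA.eigenvalues l ≤ hA.eigenvalues l₀) {v : EuclideanSpace ℝ κ} (hv : ‖v‖ = 1) :
    weightedScatter y w v ≤ hA.eigenvalues l₀ := by
  have hparseval : ∑ l, inner ℝ (hA.eigenvectorBasis l) v ^ 2 = 1 := by
    simpa only [Real.norm_eq_abs, sq_abs, hv, one_pow] using
      hA.eigenvectorBasis.sum_sq_norm_inner_right v
  calc weightedScatter y w v
      = ∑ l, hA.eigenvalues l * inner ℝ (hA.eigenvectorBasis l) v ^ 2 :=
        weightedScatter_eq_sum_eigenvalues hA v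
    _ ≤ ∑ l, hA.eigenvalues l₀ * inner ℝ (hA.eigenvectorBasis l) v ^ 2 :=
        Finset.sum_le_sum fun l _ => mul_le_mul_of_nonneg_right (hmax l) (sq_nonneg _)
    _ = hA.eigenvalues l₀ := by rw [← Finset.mul_sum, hparseval, mul_one]

theorem sum_mul_outlierScore_eq_sum (t : Finset ι) :
    ∑ i ∈ t, w i * outlierScore y w i =
      ∑ l, hA.eigenvalues l ^ 2 ^ (Fintype.card ι + Fintype.card κ) *
        ∑ i ∈ t, w i * inner ℝ (hA.eigenvectorBasis l) (y i - weightedMean y w) ^ 2 := by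
  simp only [outlierScore, dotProduct_pow_mulVec_eq_sum hA, Finset.mul_sum]
  rw [Finset.sum_comm]
  exact Finset.sum_congr rfl fun l _ => Finset.sum_congr rfl fun i _ => by ring

theorem sum_mul_outlierScore_univ :
    ∑ i, w i * outlierScore y w i =
      ∑ l, hA.eigenvalues l ^ (2 ^ (Fintype.card ι + Fintype.card κ) + 1) := by
  rw [sum_mul_outlierScore_eq_sum hA]
  refine Finset.sum_congr rfl fun l _ => ?_
  rw [pow_succ, ← weightedScatter_eigenvectorBasis hA l, weightedScatter]

theorem outlierScore_nonneg (hw : ∀ i, 0 ≤ w i) (i : ι) : 0 ≤ outlierScore y w i := by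
  have hA := posSemidef_scatterMatrix y hw
  rw [outlierScore, dotProduct_pow_mulVec_eq_sum hA.1]
  exact Finset.sum_nonneg fun l _ =>
    mul_nonneg (pow_nonneg (hA.eigenvalues_nonneg l) _) (sq_nonneg _)

theorem sum_mul_outlierScore_le (hA : (scatterMatrix y w).PosSemidef) {t : Finset ι} {c : ℝ}
    (hc : ∀ v : EuclideanSpace ℝ κ, ‖v‖ = 1 →
      ∑ i ∈ t, w i * inner ℝ v (y i - weightedMean y w) ^ 2 ≤ c) :
    ∑ i ∈ t, w i * outlierScore y w i ≤
      (∑ l, hA.1.eigenvalues l ^ 2 ^ (Fintype.card ι + Fintype.card κ)) * c := by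
  rw [sum_mul_outlierScore_eq_sum hA.1, Finset.sum_mul]
  exact Finset.sum_le_sum fun l _ => mul_le_mul_of_nonneg_left
    (hc _ (hA.1.eigenvectorBasis.orthonormal.1 l)) (pow_nonneg (hA.eigenvalues_nonneg l) _)

theorem card_mul_weightedScatter_le (hA : (scatterMatrix y w).PosSemidef) {c : ℝ} (hc : 0 ≤ c)
    (hscore : ∑ i, w i * outlierScore y w i ≤
      (∑ l, hA.1.eigenvalues l ^ 2 ^ (Fintype.card ι + Fintype.card κ)) * c)
    {v : EuclideanSpace ℝ κ} (hv : ‖v‖ = 1) :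
    Fintype.card ι * weightedScatter y w v ≤ (Fintype.card ι + 1) * c := by
  have := nonempty_of_norm_eq_one hv
  obtain ⟨l₀, hmax⟩ := Finite.exists_max hA.1.eigenvalues
  set m := 2 ^ (Fintype.card ι + Fintype.card κ)
  set P := ∑ l, hA.1.eigenvalues l ^ m
  refine (mul_le_mul_of_nonneg_left (weightedScatter_le_eigenvalue hA.1 hmax hv)
    (Nat.cast_nonneg _)).trans ?_
  rcases (hA.eigenvalues_nonneg l₀).eq_or_lt with hzero | hpos
  · rw [← hzero, mul_zero]
    positivity
  · have hP : 0 < P := (pow_pos hpos m).trans_le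
      (Finset.single_le_sum (f := fun l => hA.1.eigenvalues l ^ m)
        (fun l _ => pow_nonneg (hA.eigenvalues_nonneg l) _) (Finset.mem_univ l₀))
    have hratio := mul_max_mul_sum_pow_le
      (mul_le_two_pow_add (Fintype.card ι) (Fintype.card κ)) hA.eigenvalues_nonneg hmax
    rw [← sum_mul_outlierScore_univ hA.1] at hratio
    refine le_of_mul_le_mul_left ?_ hP
    calc P * (Fintype.card ι * hA.1.eigenvalues l₀)
        = Fintype.card ι * (hA.1.eigenvalues l₀ * P) := by ring
      _ ≤ (Fintype.card ι + 1) * ∑ i, w i * outlierScore y w i := hratio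
      _ ≤ (Fintype.card ι + 1) * (P * c) := by gcongr
      _ = P * ((Fintype.card ι + 1) * c) := by ring

end Spectral

theorem exists_forall_weightedScatter_le {ι κ : Type*} [Fintype ι] [Fintype κ] [Nonempty κ]
    {y : ι → EuclideanSpace ℝ κ} {w : ι → ℝ} (hA : (scatterMatrix y w).IsHermitian) :
    ∃ u : EuclideanSpace ℝ κ, ‖u‖ = 1 ∧
      ∀ v, ‖v‖ = 1 → weightedScatter y w v ≤ weightedScatter y w u := by
  classical
  obtain ⟨l₀, hmax⟩ := Finite.exists_max hA.eigenvalues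
  refine ⟨hA.eigenvectorBasis l₀, hA.eigenvectorBasis.orthonormal.1 l₀, fun v hv => ?_⟩
  rw [weightedScatter_eigenvectorBasis]
  exact weightedScatter_le_eigenvalue hA hmax hv

theorem inner_sq_le_norm_sq {E : Type*} [NormedAddCommGroup E] [InnerProductSpace ℝ E] {v : E}
    (hv : ‖v‖ = 1) (z : E) : inner ℝ v z ^ 2 ≤ ‖z‖ ^ 2 := by
  rw [sq_le_sq, abs_norm]
  simpa only [hv, one_mul] using abs_real_inner_le_norm v z

/-! ### When the largest scores belong to good points -/

/-- At least half of the sum of the `⌊τ⌋` largest weighted scores comes from points outside `B`. -/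
def IsTopGood {ι κ : Type*} [Fintype ι] [LinearOrder ι] [Fintype κ] [DecidableEq κ]
    (y : ι → EuclideanSpace ℝ κ) (B : Finset ι) (τ : ℝ) (w : ι → ℝ) : Prop :=
  ∑ i ∈ topSet (fun i => w i * outlierScore y w i) τ ∩ B, w i * outlierScore y w i ≤
    ∑ i ∈ topSet (fun i => w i * outlierScore y w i) τ \ B, w i * outlierScore y w i

namespace IsContaminated

section TopGood

variable {ι E : Type*} [Fintype ι] [DecidableEq ι] [NormedAddCommGroup E] [InnerProductSpace ℝ E]
  {x y : ι → E} {B : Finset ι} {μ : E} {ε s Δ : ℝ} {w : ι → ℝ} {v : E}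

theorem sum_compl_mul_inner_sub_weightedMean_sq_le (h : IsContaminated x y B μ ε s Δ)
    (hw : IsNearlyFull (ε * Fintype.card ι) w) (hv : ‖v‖ = 1) :
    ∑ i ∈ Bᶜ, w i * inner ℝ v (y i - weightedMean y w) ^ 2 ≤
      Fintype.card ι * (s + 2 * Δ + 2 * ‖weightedMean y w - μ‖ ^ 2) := by
  rw [h.sum_compl_mul_inner_sub_sq]
  have hn := h.card_pos
  have hmean := mul_le_mul_of_nonneg_left (inner_sq_le_norm_sq hv (weightedMean y w - μ)) hn.le
  set c := inner ℝ v (weightedMean y w - μ)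
  set S := ∑ i ∈ Bᶜ, w i * inner ℝ v (x i - μ)
  have hmass : c ^ 2 * ∑ i ∈ Bᶜ, w i ≤ c ^ 2 * Fintype.card ι := by
    refine mul_le_mul_of_nonneg_left ?_ (sq_nonneg c)
    refine (Finset.sum_le_card_nsmul _ w 1 fun i _ => hw.le_one i).trans ?_
    rw [nsmul_eq_mul, mul_one]
    exact_mod_cast Finset.card_le_univ _
  have hcross := two_mul_sub_sq_mul_le_sq_div (t := -c) (S := S) hn le_rfl
  have hS : S ^ 2 / Fintype.card ι ≤ Fintype.card ι * Δ := by
    rw [div_le_iff₀ hn]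
    have hsmall : 9 * ε * (Fintype.card ι ^ 2 * Δ) ≤ 1 * (Fintype.card ι ^ 2 * Δ) :=
      mul_le_mul_of_nonneg_right (by linarith [h.eps_le])
        (mul_nonneg (sq_nonneg _) h.delta_nonneg)
    linarith [h.sq_sum_compl_mul_inner_le hw hv]
  linarith [h.sum_compl_mul_sq_le hw.le_one hv]

theorem sum_sdiff_mul_inner_sub_weightedMean_sq_le (h : IsContaminated x y B μ ε s Δ)
    (hw : ∀ i, w i ≤ 1) {L : Finset ι} (hL : (L.card : ℝ) ≤ ε * Fintype.card ι) (hv : ‖v‖ = 1) :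
    ∑ i ∈ L \ B, w i * inner ℝ v (y i - weightedMean y w) ^ 2 ≤
      Fintype.card ι * (6 * Δ + 2 * ε * ‖weightedMean y w - μ‖ ^ 2) := by
  have hcard : ((L \ B).card : ℝ) ≤ ε * Fintype.card ι :=
    le_trans (by exact_mod_cast Finset.card_le_card Finset.sdiff_subset) hL
  have htail := h.tail_le v hv (fun i => if i ∈ L \ B then 1 else 0)
    (fun i => by split_ifs <;> norm_num) (fun i => by split_ifs <;> norm_num)
    (by rw [Finset.sum_ite_mem, Finset.univ_inter, Finset.sum_const, nsmul_eq_mul, mul_one]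
        linarith [h.one_le])
  simp only [ite_mul, one_mul, zero_mul, Finset.sum_ite_mem, Finset.univ_inter] at htail
  have hterm (i : ι) (hi : i ∈ L \ B) : w i * inner ℝ v (y i - weightedMean y w) ^ 2 ≤
      2 * inner ℝ v (x i - μ) ^ 2 + 2 * ‖weightedMean y w - μ‖ ^ 2 := by
    refine (mul_le_of_le_one_left (sq_nonneg _) (hw i)).trans ?_
    rw [h.inner_sub_eq_of_mem_compl v _ (Finset.mem_compl.2 (Finset.mem_sdiff.1 hi).2)]
    have hmean := inner_sq_le_norm_sq hv (weightedMean y w - μ)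
    linarith [sq_nonneg (inner ℝ v (x i - μ) + inner ℝ v (weightedMean y w - μ))]
  refine (Finset.sum_le_sum hterm).trans ?_
  rw [Finset.sum_add_distrib, ← Finset.mul_sum, Finset.sum_const, nsmul_eq_mul]
  linarith [mul_le_mul_of_nonneg_right hcard (sq_nonneg ‖weightedMean y w - μ‖)]

end TopGood

section Cardinality

variable {ι E : Type*} [Fintype ι] [NormedAddCommGroup E] [InnerProductSpace ℝ E]
  {x y : ι → E} {B : Finset ι} {μ : E} {ε s Δ : ℝ}

theorem s_le_card_mul (h : IsContaminated x y B μ ε s Δ) : s ≤ Fintype.card ι * Δ :=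
  calc s ≤ s * (ε * Fintype.card ι) := le_mul_of_one_le_right h.s_nonneg h.one_le
    _ = Fintype.card ι * (s * ε) := by ring
    _ ≤ Fintype.card ι * Δ := mul_le_mul_of_nonneg_left h.s_mul_le h.card_pos.le

variable [LinearOrder ι]

theorem card_topSet_eq (h : IsContaminated x y B μ ε s Δ) (a : ι → ℝ) :
    (topSet a (ε * Fintype.card ι)).card = ⌊ε * Fintype.card ι⌋₊ :=
  card_topSet (mul_le_of_le_one_left h.card_pos.le (by linarith [h.eps_le]))

theorem card_topSet_le (h : IsContaminated x y B μ ε s Δ) (a : ι → ℝ) :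
    ((topSet a (ε * Fintype.card ι)).card : ℝ) ≤ ε * Fintype.card ι := by
  rw [h.card_topSet_eq]
  exact Nat.floor_le (zero_le_one.trans h.one_le)

theorem card_le_card_topSet (h : IsContaminated x y B μ ε s Δ) (a : ι → ℝ) :
    B.card ≤ (topSet a (ε * Fintype.card ι)).card := by
  rw [h.card_topSet_eq]
  exact Nat.le_floor h.card_le

end Cardinality

variable {ι κ : Type*} [Fintype ι] [LinearOrder ι] [Fintype κ] [DecidableEq κ]
  {x y : ι → EuclideanSpace ℝ κ} {B : Finset ι} {μ : EuclideanSpace ℝ κ} {ε s Δ : ℝ}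
  {w : ι → ℝ}

theorem sum_mul_outlierScore_le_of_isTopGood (h : IsContaminated x y B μ ε s Δ)
    (hw : IsNearlyFull (ε * Fintype.card ι) w) (hA : (scatterMatrix y w).PosSemidef)
    (hgood : IsTopGood y B (ε * Fintype.card ι) w) :
    ∑ i, w i * outlierScore y w i ≤
      (∑ l, hA.1.eigenvalues l ^ 2 ^ (Fintype.card ι + Fintype.card κ)) *
        (Fintype.card ι * (s + 14 * Δ + 3 * ‖weightedMean y w - μ‖ ^ 2)) := by
  set a := fun i => w i * outlierScore y w i
  set L := topSet a (ε * Fintype.card ι)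
  set P := ∑ l, hA.1.eigenvalues l ^ 2 ^ (Fintype.card ι + Fintype.card κ)
  set e := ‖weightedMean y w - μ‖ ^ 2
  have ha_nonneg (i : ι) : 0 ≤ a i := mul_nonneg (hw.nonneg i) (outlierScore_nonneg hw.nonneg i)
  have hcompl : ∑ i ∈ Bᶜ, a i ≤ P * (Fintype.card ι * (s + 2 * Δ + 2 * e)) :=
    sum_mul_outlierScore_le hA fun v hv => h.sum_compl_mul_inner_sub_weightedMean_sq_le hw hv
  have htopGood : ∑ i ∈ L \ B, a i ≤ P * (Fintype.card ι * (6 * Δ + 2 * ε * e)) :=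
    sum_mul_outlierScore_le hA fun v hv =>
      h.sum_sdiff_mul_inner_sub_weightedMean_sq_le hw.le_one (h.card_topSet_le a) hv
  have hbad : ∑ i ∈ B, a i ≤ ∑ i ∈ L, a i := sum_le_sum_topSet ha_nonneg (h.card_le_card_topSet a)
  have hP : 0 ≤ P * Fintype.card ι :=
    mul_nonneg (Finset.sum_nonneg fun l _ => pow_nonneg (hA.eigenvalues_nonneg l) _)
      (Nat.cast_nonneg _)
  have heps : ε * e ≤ 1 / 2000 * e := mul_le_mul_of_nonneg_right h.eps_le (sq_nonneg _)
  calc ∑ i, a i = ∑ i ∈ B, a i + ∑ i ∈ Bᶜ, a i := (Finset.sum_add_sum_compl B a).symm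
    _ ≤ 2 * ∑ i ∈ L \ B, a i + ∑ i ∈ Bᶜ, a i := by
        linarith [Finset.sum_inter_add_sum_sdiff L B a, show ∑ i ∈ L ∩ B, a i ≤ _ from hgood]
    _ ≤ P * Fintype.card ι * (s + 14 * Δ + 2 * e + 4 * (ε * e)) := by linarith
    _ ≤ P * Fintype.card ι * (s + 14 * Δ + 3 * e) :=
        mul_le_mul_of_nonneg_left (by linarith [sq_nonneg ‖weightedMean y w - μ‖]) hP
    _ = P * (Fintype.card ι * (s + 14 * Δ + 3 * e)) := mul_assoc _ _ _

/-- The error of the mean contributes to the bound on the total score only `ε` times the excess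
`Λ`, so that a crude bound on the second moment improves itself. -/
theorem weightedScatter_le_add_div_four (h : IsContaminated x y B μ ε s Δ)
    (hw : IsNearlyFull (ε * Fintype.card ι) w) (hgood : IsTopGood y B (ε * Fintype.card ι) w)
    {Λ : ℝ} (hΛ : 0 ≤ Λ)
    (hscatter : ∀ v, ‖v‖ = 1 → weightedScatter y w v ≤ Fintype.card ι * (s + Λ))
    {v : EuclideanSpace ℝ κ} (hv : ‖v‖ = 1) :
    weightedScatter y w v ≤ Fintype.card ι * (s + (31 * Δ + Λ / 4)) := by
  have hA := posSemidef_scatterMatrix y hw.nonneg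
  have hn := h.card_pos
  have hn_one : (1 : ℝ) ≤ Fintype.card ι := by exact_mod_cast hn
  have hΔ := h.delta_nonneg
  have herror : 3 * ‖weightedMean y w - μ‖ ^ 2 ≤ Δ + Λ / 8 := by
    have heps : ε * (112 * Δ + 8 * Λ) ≤ 1 / 2000 * (112 * Δ + 8 * Λ) :=
      mul_le_mul_of_nonneg_right h.eps_le (by linarith)
    linarith [h.norm_weightedMean_sub_sq_le hw hΛ hscatter]
  have hspectral := card_mul_weightedScatter_le hA
    (mul_nonneg hn.le (by linarith [h.s_nonneg, sq_nonneg ‖weightedMean y w - μ‖]))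
    (h.sum_mul_outlierScore_le_of_isTopGood hw hA hgood) hv
  refine le_of_mul_le_mul_left (hspectral.trans ?_) hn
  rw [mul_left_comm]
  refine mul_le_mul_of_nonneg_left ?_ hn.le
  calc (Fintype.card ι + 1) * (s + 14 * Δ + 3 * ‖weightedMean y w - μ‖ ^ 2)
      ≤ (Fintype.card ι + 1) * (s + (15 * Δ + Λ / 8)) :=
        mul_le_mul_of_nonneg_left (by linarith) (by linarith)
    _ = Fintype.card ι * (s + (15 * Δ + Λ / 8)) + s + 1 * (15 * Δ + Λ / 8) := by ring
    _ ≤ Fintype.card ι * (s + (15 * Δ + Λ / 8)) + Fintype.card ι * Δ +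
          Fintype.card ι * (15 * Δ + Λ / 8) :=
        add_le_add (add_le_add_right h.s_le_card_mul _)
          (mul_le_mul_of_nonneg_right hn_one (by linarith))
    _ = Fintype.card ι * (s + (31 * Δ + Λ / 4)) := by ring

theorem weightedScatter_le_of_isTopGood (h : IsContaminated x y B μ ε s Δ)
    (hw : IsNearlyFull (ε * Fintype.card ι) w) (hgood : IsTopGood y B (ε * Fintype.card ι) w)
    {v : EuclideanSpace ℝ κ} (hv : ‖v‖ = 1) :
    weightedScatter y w v ≤ Fintype.card ι * (s + 42 * Δ) := by
  have := nonempty_of_norm_eq_one hv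
  have hn := h.card_pos
  obtain ⟨u, hu, hmax⟩ :=
    exists_forall_weightedScatter_le (posSemidef_scatterMatrix y hw.nonneg).1
  refine (hmax v hv).trans ?_
  by_contra! hlarge
  obtain ⟨Λ, hΛ⟩ : ∃ Λ, weightedScatter y w u = Fintype.card ι * (s + Λ) :=
    ⟨weightedScatter y w u / Fintype.card ι - s, by field_simp; ring⟩
  have hexcess : 42 * Δ < Λ := by
    rw [hΛ] at hlarge
    linarith [lt_of_mul_lt_mul_left hlarge hn.le]
  have hbound := h.weightedScatter_le_add_div_four hw hgood
    (by linarith [h.delta_nonneg]) (fun v hv => hΛ ▸ hmax v hv) hu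
  rw [hΛ] at hbound
  linarith [le_of_mul_le_mul_left hbound hn, h.delta_nonneg]

end IsContaminated

/-! ### The filter -/

section Downweight

variable {ι : Type*} {w g : ι → ℝ} {L : Finset ι} {i : ι}

/-- The largest score `g i` of a point of positive weight in `L`, or `0` if all these are
negative. -/
noncomputable def maxScore (w g : ι → ℝ) (L : Finset ι) : ℝ :=
  (L.filter fun i => 0 < w i).fold max 0 g

theorem maxScore_nonneg : 0 ≤ maxScore w g L :=
  (Finset.le_fold_max 0).2 (Or.inl le_rfl)

theorem le_maxScore (hi : i ∈ L) (hwi : 0 < w i) : g i ≤ maxScore w g L :=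
  (Finset.le_fold_max _).2 (Or.inr ⟨i, Finset.mem_filter.2 ⟨hi, hwi⟩, le_rfl⟩)

theorem exists_eq_maxScore (hpos : 0 < maxScore w g L) :
    ∃ i ∈ L, 0 < w i ∧ g i = maxScore w g L := by
  rcases (Finset.le_fold_max (maxScore w g L)).1 le_rfl with hle | ⟨i, hi, hle⟩
  · exact absurd hle (not_le.2 hpos)
  · obtain ⟨hiL, hwi⟩ := Finset.mem_filter.1 hi
    exact ⟨i, hiL, hwi, (le_maxScore hiL hwi).antisymm hle⟩

variable [DecidableEq ι]

/-- The weights on `L`, lowered in proportion to the scores `g` as far as they stay nonnegative. -/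
noncomputable def downweight (w g : ι → ℝ) (L : Finset ι) (i : ι) : ℝ :=
  if i ∈ L then w i - w i * g i / maxScore w g L else w i

theorem downweight_le (hw : ∀ i, 0 ≤ w i) (hg : ∀ i, 0 ≤ g i) (i : ι) :
    downweight w g L i ≤ w i := by
  unfold downweight
  split_ifs
  exacts [sub_le_self _ (div_nonneg (mul_nonneg (hw i) (hg i)) maxScore_nonneg), le_rfl]

theorem downweight_nonneg (hw : ∀ i, 0 ≤ w i) (i : ι) : 0 ≤ downweight w g L i := by
  unfold downweight
  split_ifs with hi
  · rcases (hw i).eq_or_lt with hzero | hpos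
    · simp [← hzero]
    · rw [sub_nonneg, mul_div_assoc]
      exact mul_le_of_le_one_right hpos.le
        (div_le_one_of_le₀ (le_maxScore hi hpos) maxScore_nonneg)
  · exact hw i

theorem exists_downweight_eq_zero (hpos : 0 < maxScore w g L) :
    ∃ i, 0 < w i ∧ downweight w g L i = 0 := by
  obtain ⟨i, hi, hwi, hgi⟩ := exists_eq_maxScore hpos
  refine ⟨i, hwi, ?_⟩
  rw [downweight, if_pos hi, hgi, mul_div_cancel_right₀ _ hpos.ne', sub_self]

theorem sum_one_sub_downweight (t : Finset ι) :
    ∑ i ∈ t, (1 - downweight w g L i) =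
      ∑ i ∈ t, (1 - w i) + (∑ i ∈ L ∩ t, w i * g i) / maxScore w g L := by
  rw [Finset.sum_div, Finset.inter_comm, ← Finset.sum_ite_mem, ← Finset.sum_add_distrib]
  refine Finset.sum_congr rfl fun i _ => ?_
  unfold downweight
  split_ifs <;> ring

variable [Fintype ι]

/-- At most as much weight has been removed outside `B` as on `B`. -/
def RemovesMoreBad (B : Finset ι) (w : ι → ℝ) : Prop :=
  ∑ i ∈ Bᶜ, (1 - w i) ≤ ∑ i ∈ B, (1 - w i)

theorem RemovesMoreBad.sum_one_sub_le {B : Finset ι} {τ : ℝ} (hB : RemovesMoreBad B w)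
    (hcard : (B.card : ℝ) ≤ τ) (hw : ∀ i, 0 ≤ w i) : ∑ i, (1 - w i) ≤ 2 * τ := by
  have hbad : ∑ i ∈ B, (1 - w i) ≤ B.card := by
    simpa using Finset.sum_le_card_nsmul B _ 1 fun i _ => sub_le_self 1 (hw i)
  have hgood : ∑ i ∈ Bᶜ, (1 - w i) ≤ ∑ i ∈ B, (1 - w i) := hB
  rw [← Finset.sum_add_sum_compl B]
  linarith

theorem RemovesMoreBad.downweight {B : Finset ι} (hB : RemovesMoreBad B w)
    (hscore : ∑ i ∈ L \ B, w i * g i ≤ ∑ i ∈ L ∩ B, w i * g i) :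
    RemovesMoreBad B (downweight w g L) := by
  rw [RemovesMoreBad, sum_one_sub_downweight, sum_one_sub_downweight,
    ← Finset.sdiff_eq_inter_compl]
  exact add_le_add hB (div_le_div_of_nonneg_right hscore maxScore_nonneg)

end Downweight

section FilterStep

variable {ι κ : Type*} [Fintype ι] [LinearOrder ι] [Fintype κ] [DecidableEq κ]
  {y : ι → EuclideanSpace ℝ κ} {τ : ℝ} {w : ι → ℝ}

/-- The weights of the `⌊τ⌋` points with the largest weighted outlier scores, lowered in proportion
to the scores until one of them vanishes. -/
noncomputable def lowerTopScores (y : ι → EuclideanSpace ℝ κ) (τ : ℝ) (w : ι → ℝ) : ι → ℝ :=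
  downweight w (outlierScore y w) (topSet (fun i => w i * outlierScore y w i) τ)

/-- One step of the filter: it lowers the top scores, unless the weight removed altogether would
then exceed `2 τ`. -/
noncomputable def filterStep (y : ι → EuclideanSpace ℝ κ) (τ : ℝ) (w : ι → ℝ) : ι → ℝ :=
  if ∑ i, (1 - lowerTopScores y τ w i) ≤ 2 * τ then lowerTopScores y τ w else w

theorem filterStep_le (hw : ∀ i, 0 ≤ w i) : filterStep y τ w ≤ w := by
  unfold filterStep
  split_ifs
  exacts [fun i => downweight_le hw (outlierScore_nonneg hw) i, le_rfl]

theorem isNearlyFull_filterStep (hw : IsNearlyFull τ w) :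
    IsNearlyFull τ (filterStep y τ w) where
  nonneg := by
    unfold filterStep
    split_ifs
    exacts [downweight_nonneg hw.nonneg, hw.nonneg]
  le_one i := (filterStep_le hw.nonneg i).trans (hw.le_one i)
  sum_one_sub_le := by
    unfold filterStep
    split_ifs with haccept
    exacts [haccept, hw.sum_one_sub_le]

theorem filterStep_eq_self (hτ : τ < 1) : filterStep y τ w = w := by
  have hlower : lowerTopScores y τ w = w := by
    funext i
    rw [lowerTopScores, topSet_eq_empty hτ, downweight, if_neg (Finset.notMem_empty i)]
  rw [filterStep, hlower, ite_self]

theorem isNearlyFull_iterate_filterStep (hτ : 0 ≤ τ) (k : ℕ) :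
    IsNearlyFull τ ((filterStep y τ)^[k] 1) := by
  induction k with
  | zero => exact ⟨fun _ => zero_le_one, fun _ => le_rfl, by simpa using hτ⟩
  | succ k ih =>
    rw [Function.iterate_succ_apply']
    exact isNearlyFull_filterStep ih

theorem antitone_iterate_filterStep (hτ : 0 ≤ τ) :
    Antitone fun k => (filterStep y τ)^[k] 1 :=
  antitone_nat_of_succ_le fun k => by
    rw [Function.iterate_succ_apply']
    exact filterStep_le (isNearlyFull_iterate_filterStep hτ k).nonneg

namespace IsContaminated

variable {x : ι → EuclideanSpace ℝ κ} {B : Finset ι} {μ : EuclideanSpace ℝ κ} {ε s Δ : ℝ}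

theorem removesMoreBad_filterStep (h : IsContaminated x y B μ ε s Δ) (hw : ∀ i, 0 ≤ w i)
    (hB : RemovesMoreBad B w) (hbad : ¬ IsTopGood y B (ε * Fintype.card ι) w) :
    RemovesMoreBad B (filterStep y (ε * Fintype.card ι) w) ∧
      ∃ i, 0 < w i ∧ filterStep y (ε * Fintype.card ι) w i = 0 := by
  rw [IsTopGood, not_le] at hbad
  set g := outlierScore y w
  set L := topSet (fun i => w i * g i) (ε * Fintype.card ι)
  have hg : ∀ i, 0 ≤ g i := outlierScore_nonneg hw
  have hlowered : RemovesMoreBad B (lowerTopScores y (ε * Fintype.card ι) w) :=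
    hB.downweight hbad.le
  have haccept : filterStep y (ε * Fintype.card ι) w = lowerTopScores y (ε * Fintype.card ι) w :=
    if_pos (hlowered.sum_one_sub_le h.card_le (downweight_nonneg hw))
  have hpos : 0 < maxScore w g L := by
    have hgood : 0 ≤ ∑ i ∈ L \ B, w i * g i :=
      Finset.sum_nonneg fun i _ => mul_nonneg (hw i) (hg i)
    obtain ⟨i, hi, hne⟩ := Finset.exists_ne_zero_of_sum_ne_zero (hgood.trans_lt hbad).ne'
    exact ((hg i).lt_of_ne' (right_ne_zero_of_mul hne)).trans_le
      (le_maxScore (Finset.mem_inter.1 hi).1 ((hw i).lt_of_ne' (left_ne_zero_of_mul hne)))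
  rw [haccept]
  exact ⟨hlowered, exists_downweight_eq_zero hpos⟩

theorem exists_isTopGood_iterate_filterStep (h : IsContaminated x y B μ ε s Δ) :
    ∃ k < Fintype.card ι,
      IsTopGood y B (ε * Fintype.card ι) ((filterStep y (ε * Fintype.card ι))^[k] 1) := by
  by_contra! hbad
  set W := fun k => (filterStep y (ε * Fintype.card ι))^[k] 1 with hW
  have hτ : 0 ≤ ε * Fintype.card ι := zero_le_one.trans h.one_le
  have hfull (k : ℕ) : IsNearlyFull (ε * Fintype.card ι) (W k) :=
    isNearlyFull_iterate_filterStep hτ k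
  have hcount (k : ℕ) : k ≤ Fintype.card ι →
      RemovesMoreBad B (W k) ∧ k ≤ (Finset.univ.filter fun i => W k i = 0).card := by
    induction k with
    | zero => exact fun _ => ⟨by simp [RemovesMoreBad, hW], Nat.zero_le _⟩
    | succ k ih =>
      intro hk
      obtain ⟨hB, hzeros⟩ := ih (Nat.le_of_succ_le hk)
      obtain ⟨hB', i, hpos, hzero⟩ := h.removesMoreBad_filterStep (hfull k).nonneg hB (hbad k hk)
      have hsucc : W (k + 1) = filterStep y (ε * Fintype.card ι) (W k) :=
        Function.iterate_succ_apply' _ _ _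
      rw [hsucc]
      refine ⟨hB', Nat.succ_le_of_lt (hzeros.trans_lt (Finset.card_lt_card ?_))⟩
      refine (Finset.ssubset_iff_of_subset fun j hj => ?_).2
        ⟨i, by simpa using hzero, by simpa using hpos.ne'⟩
      rw [Finset.mem_filter_univ] at hj ⊢
      exact le_antisymm ((filterStep_le (hfull k).nonneg j).trans_eq hj)
        ((isNearlyFull_filterStep (hfull k)).nonneg j)
  have hall : (Finset.univ.filter fun i => W (Fintype.card ι) i = 0) = Finset.univ :=
    Finset.eq_univ_of_card _ (le_antisymm (Finset.card_le_univ _) (hcount _ le_rfl).2)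
  refine (h.sum_weight_pos (hfull (Fintype.card ι))).ne' (Finset.sum_eq_zero fun i hi => ?_)
  rwa [← hall, Finset.mem_filter_univ] at hi

theorem norm_weightedMean_iterate_filterStep_sub_sq_le (h : IsContaminated x y B μ ε s Δ) :
    ‖weightedMean y ((filterStep y (ε * Fintype.card ι))^[Fintype.card ι] 1) - μ‖ ^ 2 ≤
      ε * (448 * Δ) := by
  have hτ : 0 ≤ ε * Fintype.card ι := zero_le_one.trans h.one_le
  obtain ⟨k, hk, hgood⟩ := h.exists_isTopGood_iterate_filterStep
  have hfull := isNearlyFull_iterate_filterStep (y := y) hτ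
  have hle := antitone_iterate_filterStep (y := y) hτ hk.le
  refine (h.norm_weightedMean_sub_sq_le (hfull _) (Λ := 42 * Δ)
    (by linarith [h.delta_nonneg]) fun v hv => ?_).trans_eq (by ring)
  exact (weightedScatter_mono y (h.sum_weight_pos (hfull _)) hle v).trans
    (h.weightedScatter_le_of_isTopGood (hfull k) hgood hv)

end IsContaminated

end FilterStep

/-! ### Stable sets -/

open Matrix in
theorem inner_toEuclideanCLM_subSecondMoment {n d : ℕ} (x : Points n d) (μ : RVec d)
    (I : Finset (Fin n)) (s : ℝ) (v : RVec d) :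
    inner ℝ v (toEuclideanCLM (n := Fin d) (𝕜 := ℝ)
      (subSecondMoment x μ I - s • (1 : Matrix (Fin d) (Fin d) ℝ)) v) =
      (I.card : ℝ)⁻¹ * ∑ i ∈ I, inner ℝ v (x i - μ) ^ 2 - s * ‖v‖ ^ 2 := by
  have hself : v.ofLp ⬝ᵥ v.ofLp = ‖v‖ ^ 2 := by
    rw [← real_inner_self_eq_norm_sq, EuclideanSpace.inner_eq_star_dotProduct, star_trivial]
  rw [inner_toEuclideanCLM, sub_mulVec, dotProduct_sub, smul_mulVec, one_mulVec, dotProduct_smul,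
    hself, subSecondMoment, smul_mulVec, dotProduct_smul, sum_mulVec, dotProduct_sum, smul_eq_mul,
    smul_eq_mul]
  simp only [dotProduct_vecMulVec_self_mulVec]

theorem sum_sub_subMean_univ {n d : ℕ} (x : Points n d) (hn : n ≠ 0) :
    ∑ i, (x i - subMean x Finset.univ) = 0 := by
  rw [Finset.sum_sub_distrib, subMean]
  simp only [Finset.sum_const, Finset.card_univ, Fintype.card_fin, ← Nat.cast_smul_eq_nsmul ℝ]
  rw [smul_smul, mul_inv_cancel₀ (Nat.cast_ne_zero.2 hn), one_smul, sub_self]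

theorem subMean_univ_eq_weightedMean {n d : ℕ} (x : Points n d) :
    subMean x Finset.univ = weightedMean x 1 := by
  simp [subMean, weightedMean, Finset.centerMass]

theorem IsCorruption.eq_of_mul_lt_one {n d : ℕ} {ε : ℝ} {S T : Points n d}
    (hT : IsCorruption ε S T) (hε : ε * n < 1) : T = S := by
  have hncard : {i | T i ≠ S i}.ncard = 0 :=
    Nat.lt_one_iff.1 (by exact_mod_cast hT.trans_lt hε)
  rw [Set.ncard_eq_zero (Set.toFinite _)] at hncard
  funext i
  by_contra hi
  exact Set.eq_empty_iff_forall_notMem.1 hncard i hi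

namespace IsStable

section Moments

variable {n d : ℕ} {η δ σ : ℝ} {x : Points n d} {μ v : RVec d}

theorem abs_sum_inner_sq_sub_le (h : IsStable η δ x μ σ) {I : Finset (Fin n)}
    (hI : (1 - η) * n ≤ I.card) (hI_pos : 0 < I.card) (hv : ‖v‖ = 1) :
    |∑ i ∈ I, inner ℝ v (x i - μ) ^ 2 - I.card * σ ^ 2| ≤ I.card * (σ ^ 2 * δ ^ 2 / η) := by
  set A := Matrix.toEuclideanCLM (n := Fin d) (𝕜 := ℝ)
    (subSecondMoment x μ I - σ ^ 2 • (1 : Matrix (Fin d) (Fin d) ℝ)) with hA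
  have hform : |inner ℝ v (A v)| ≤ σ ^ 2 * δ ^ 2 / η :=
    calc |inner ℝ v (A v)| ≤ ‖v‖ * ‖A v‖ := abs_real_inner_le_norm v (A v)
      _ ≤ ‖A‖ := by simpa only [hv, one_mul, mul_one] using A.le_opNorm v
      _ ≤ σ ^ 2 * δ ^ 2 / η := h.secondMoment_close I hI
  have hcard : (0 : ℝ) < I.card := by exact_mod_cast hI_pos
  rw [hA, inner_toEuclideanCLM_subSecondMoment, hv, one_pow, mul_one] at hform
  rw [← mul_le_mul_iff_right₀ hcard] at hform
  calc |∑ i ∈ I, inner ℝ v (x i - μ) ^ 2 - I.card * σ ^ 2|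
      = I.card * |(I.card : ℝ)⁻¹ * ∑ i ∈ I, inner ℝ v (x i - μ) ^ 2 - σ ^ 2| := by
        rw [← abs_of_pos hcard, ← abs_mul, abs_of_pos hcard, mul_sub,
          mul_inv_cancel_left₀ hcard.ne']
    _ ≤ I.card * (σ ^ 2 * δ ^ 2 / η) := hform

theorem abs_sum_univ_inner_sq_sub_le (h : IsStable η δ x μ σ) (hn : 0 < n) (hv : ‖v‖ = 1) :
    |∑ i, inner ℝ v (x i - μ) ^ 2 - n * σ ^ 2| ≤ n * (σ ^ 2 * δ ^ 2 / η) := by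
  have huniv := h.abs_sum_inner_sq_sub_le (I := Finset.univ) (by
    rw [Finset.card_univ, Fintype.card_fin]
    exact mul_le_of_le_one_left (Nat.cast_nonneg n) (by linarith [h.eps_pos]))
    (by simpa using hn) hv
  simpa only [Finset.card_univ, Fintype.card_fin] using huniv

theorem sq_mul_le_div (h : IsStable η δ x μ σ) : σ ^ 2 * η ≤ σ ^ 2 * δ ^ 2 / η := by
  rw [le_div_iff₀ h.eps_pos, mul_assoc, ← sq]
  exact mul_le_mul_of_nonneg_left (pow_le_pow_left₀ h.eps_pos.le h.eps_le 2) (sq_nonneg σ)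

theorem sum_topSet_inner_sq_le (h : IsStable η δ x μ σ) (hv : ‖v‖ = 1) {K : ℕ}
    (hK : K ≤ η * n) (hKn : K < n) :
    ∑ i ∈ topSet (fun i => inner ℝ v (x i - μ) ^ 2) K, inner ℝ v (x i - μ) ^ 2 ≤
      K * σ ^ 2 + 2 * n * (σ ^ 2 * δ ^ 2 / η) := by
  set L := topSet (fun i => inner ℝ v (x i - μ) ^ 2) (K : ℝ)
  have hL : L.card = K := by
    rw [card_topSet (by rw [Fintype.card_fin]; exact_mod_cast hKn.le), Nat.floor_natCast]
  have hcompl : (Lᶜ).card = n - K := by rw [Finset.card_compl, Fintype.card_fin, hL]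
  have hcompl' : ((Lᶜ).card : ℝ) = n - K := by rw [hcompl, Nat.cast_sub hKn.le]
  have hrest := (abs_le.1 (h.abs_sum_inner_sq_sub_le (I := Lᶜ) (by rw [hcompl']; linarith)
    (by omega) hv)).1
  have hall := (abs_le.1 (h.abs_sum_univ_inner_sq_sub_le (Nat.zero_lt_of_lt hKn) hv)).2
  have hsplit := Finset.sum_add_sum_compl L fun i => inner ℝ v (x i - μ) ^ 2
  have hΔ : 0 ≤ σ ^ 2 * δ ^ 2 / η :=
    (mul_nonneg (sq_nonneg σ) h.eps_pos.le).trans h.sq_mul_le_div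
  rw [hcompl'] at hrest
  linarith [mul_nonneg K.cast_nonneg hΔ]

end Moments

section Corruption

variable {n d : ℕ} {C ε δ σ : ℝ} {S T : Points n d}

theorem sum_mul_inner_sq_le {μ v : RVec d} (hS : IsStable (C * ε) δ S μ σ) (hC : 1000 ≤ C)
    (hε : 1 ≤ ε * n) (hv : ‖v‖ = 1) {u : Fin n → ℝ} (hu : ∀ i, 0 ≤ u i) (hu_le : ∀ i, u i ≤ 1)
    (hsum : ∑ i, u i ≤ 3 * (ε * n)) :
    ∑ i, u i * inner ℝ v (S i - μ) ^ 2 ≤ 3 * n * (σ ^ 2 * δ ^ 2 / (C * ε)) := by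
  set K := ⌈3 * (ε * n)⌉₊
  have hK_ge : 3 * (ε * n) ≤ K := Nat.le_ceil _
  have hK_lt : (K : ℝ) < 3 * (ε * n) + 1 := Nat.ceil_lt_add_one (by linarith)
  have hCε : 1000 * (ε * n) ≤ C * ε * n := by
    rw [mul_assoc]
    exact mul_le_mul_of_nonneg_right hC (by linarith)
  have hKn : (K : ℝ) < n := by nlinarith [hS.eps_lt]
  have hcard : ∑ i, u i ≤ (topSet (fun i => inner ℝ v (S i - μ) ^ 2) (K : ℝ)).card := by
    rw [card_topSet (by rw [Fintype.card_fin]; exact hKn.le), Nat.floor_natCast]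
    linarith
  have hsq : K * σ ^ 2 ≤ n * (σ ^ 2 * δ ^ 2 / (C * ε)) :=
    calc K * σ ^ 2 ≤ C * ε * n * σ ^ 2 := mul_le_mul_of_nonneg_right (by linarith) (sq_nonneg σ)
      _ = n * (σ ^ 2 * (C * ε)) := by ring
      _ ≤ n * (σ ^ 2 * δ ^ 2 / (C * ε)) :=
        mul_le_mul_of_nonneg_left hS.sq_mul_le_div n.cast_nonneg
  calc ∑ i, u i * inner ℝ v (S i - μ) ^ 2
      ≤ ∑ i ∈ topSet (fun i => inner ℝ v (S i - μ) ^ 2) (K : ℝ), inner ℝ v (S i - μ) ^ 2 :=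
        sum_mul_le_sum_topSet (fun i => sq_nonneg _) hu hu_le hcard
    _ ≤ K * σ ^ 2 + 2 * n * (σ ^ 2 * δ ^ 2 / (C * ε)) :=
        hS.sum_topSet_inner_sq_le hv (by linarith) (by exact_mod_cast hKn)
    _ ≤ 3 * n * (σ ^ 2 * δ ^ 2 / (C * ε)) := by linarith

open Classical in
theorem isContaminated (hS : IsStable (C * ε) δ S (subMean S Finset.univ) σ) (hC : 1000 ≤ C)
    (hn : 0 < n) (hT : IsCorruption ε S T) (hε : 1 ≤ ε * n) :
    IsContaminated S T (Finset.univ.filter fun i => T i ≠ S i) (subMean S Finset.univ) ε (σ ^ 2)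
      (σ ^ 2 * δ ^ 2 / (C * ε)) where
  agree i hi := by simpa using hi
  card_le := by
    rwa [← Set.ncard_coe_finset, Finset.coe_filter_univ, Fintype.card_fin]
  centered := sum_sub_subMean_univ S hn.ne'
  eps_le := by nlinarith [hS.eps_lt, hS.eps_pos]
  one_le := by rwa [Fintype.card_fin]
  s_nonneg := sq_nonneg σ
  s_mul_le := (mul_le_mul_of_nonneg_left (by nlinarith [hS.eps_pos]) (sq_nonneg σ)).trans
    hS.sq_mul_le_div
  moment_ge v hv := by
    rw [Fintype.card_fin]
    linarith [(abs_le.1 (hS.abs_sum_univ_inner_sq_sub_le hn hv)).1]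
  moment_le v hv := by
    rw [Fintype.card_fin]
    linarith [(abs_le.1 (hS.abs_sum_univ_inner_sq_sub_le hn hv)).2]
  tail_le v hv u hu hu_le hsum := by
    rw [Fintype.card_fin] at hsum ⊢
    exact hS.sum_mul_inner_sq_le hC hε hv hu hu_le hsum

theorem norm_subMean_sub_weightedMean_le
    (hS : IsStable (C * ε) δ S (subMean S Finset.univ) σ) (hC : 1000 ≤ C) (hn : 0 < n)
    (hσ : 0 ≤ σ) (hT : IsCorruption ε S T) :
    ‖subMean S Finset.univ - weightedMean T ((filterStep T (ε * n))^[n] 1)‖ ≤ σ * δ := by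
  have hδ : 0 ≤ σ * δ := mul_nonneg hσ (hS.eps_pos.le.trans hS.eps_le)
  rcases le_or_gt 1 (ε * n) with hε | hε
  · have herror :=
      (hS.isContaminated hC hn hT hε).norm_weightedMean_iterate_filterStep_sub_sq_le
    rw [Fintype.card_fin] at herror
    rw [norm_sub_rev]
    refine le_of_sq_le_sq ?_ hδ
    calc _ ≤ ε * (448 * (σ ^ 2 * δ ^ 2 / (C * ε))) := herror
      _ = 448 / C * (σ * δ) ^ 2 := by
        have : ε ≠ 0 := right_ne_zero_of_mul hS.eps_pos.ne'
        field_simp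
      _ ≤ (σ * δ) ^ 2 := mul_le_of_le_one_left (sq_nonneg _)
        ((div_le_one (by linarith)).2 (by linarith))
  · rw [Function.iterate_fixed (filterStep_eq_self hε), hT.eq_of_mul_lt_one hε,
      subMean_univ_eq_weightedMean, sub_self, norm_zero]
    exact hδ

end Corruption

end IsStable

/-! ### Counted loops on the real RAM -/

namespace RealRAM

/-- The contents of the real arrays. -/
abbrev Mem : Type := ℕ → ℕ → ℕ → ℝ

/-- `while r + 1 ≤ b do (P; r := r + 1)`. -/
def countingLoop (r : ℕ) (b : NExp) (P : Prog) : Prog :=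
  .loop (.natLe (.add (.reg r) (.lit 1)) b) (.seq P (.setNat r (.add (.reg r) (.lit 1))))

/-- `for r in 0, …, b - 1 do P`. -/
def forLoop (r : ℕ) (b : NExp) (P : Prog) : Prog :=
  .seq (.setNat r (.lit 0)) (countingLoop r b P)

theorem updNat_nat (s : Store) (r k : ℕ) : (s.updNat r k).nat = Function.update s.nat r k := by
  funext q
  simp [Store.updNat, Function.update_apply]

/-- `P` transforms the arrays by `f`, which may depend on the registers below `D`, in a number of
steps polynomial in the sum of the first two registers. It preserves the registers below `D` and
may use the others as scratch space. -/
structure Computes (D : ℕ) (P : Prog) (f : (ℕ → ℕ) → Mem → Mem) : Prop where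
  dependsOn : DependsOn f (Set.Iio D)
  exists_exec : ∃ p : Polynomial ℕ, ∀ s : Store, ∃ t s', Exec P s t s' ∧
    t ≤ p.eval (s.nat 0 + s.nat 1) ∧ s'.real = f s.nat s.real ∧ Set.EqOn s'.nat s.nat (Set.Iio D)

/-- The expression `b` evaluates to `N n d`, where `n` and `d` are the contents of the first two
registers, and `N` grows at most linearly. -/
structure IsSize (b : NExp) (N : ℕ → ℕ → ℕ) : Prop where
  eval_eq : ∀ s : Store, b.eval s = N (s.nat 0) (s.nat 1)
  le_add : ∀ n d, N n d ≤ n + d + 1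

theorem isSize_one : IsSize (.lit 1) fun _ _ => 1 := ⟨fun _ => rfl, fun _ _ => by omega⟩

theorem isSize_fst : IsSize (.reg 0) fun n _ => n := ⟨fun _ => rfl, fun _ _ => by omega⟩

theorem isSize_snd : IsSize (.reg 1) fun _ d => d := ⟨fun _ => rfl, fun _ _ => by omega⟩

theorem isSize_add : IsSize (.add (.reg 0) (.reg 1)) fun n d => n + d :=
  ⟨fun _ => rfl, fun _ _ => by omega⟩

theorem eqOn_update_iff {D k : ℕ} {u v : ℕ → ℕ} :
    Set.EqOn u (Function.update v D k) (Set.Iio (D + 1)) ↔ u D = k ∧ Set.EqOn u v (Set.Iio D) := by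
  refine ⟨fun h => ⟨?_, fun r hr => ?_⟩, fun ⟨hD, h⟩ r hr => ?_⟩
  · rw [h (Nat.lt_succ_self D), Function.update_self]
  · rw [h (hr.trans (Nat.lt_succ_self D)), Function.update_of_ne (ne_of_lt hr)]
  · rcases eq_or_ne r D with rfl | hne
    · rw [hD, Function.update_self]
    · rw [Function.update_of_ne hne, h (lt_of_le_of_ne (Nat.lt_succ_iff.1 hr) hne)]

theorem exists_exec_countingLoop {D T N : ℕ} {b : NExp} {P : Prog} {f : (ℕ → ℕ) → Mem → Mem}
    {v : ℕ → ℕ} (hf : DependsOn f (Set.Iio (D + 1)))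
    (hb : ∀ s : Store, Set.EqOn s.nat v (Set.Iio D) → b.eval s = N)
    (hP : ∀ s : Store, Set.EqOn s.nat v (Set.Iio D) → ∃ t s', Exec P s t s' ∧ t ≤ T ∧
      s'.real = f s.nat s.real ∧ Set.EqOn s'.nat s.nat (Set.Iio (D + 1)))
    (m k : ℕ) (hmk : k + m = N) (s : Store) (hk : s.nat D = k)
    (hv : Set.EqOn s.nat v (Set.Iio D)) :
    ∃ t s', Exec (countingLoop D b P) s t s' ∧ t ≤ (m + 1) * (T + b.cost + 9) ∧
      s'.real = (List.range' k m).foldl (fun R l => f (Function.update v D l) R) s.real ∧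
      Set.EqOn s'.nat v (Set.Iio D) := by
  induction m generalizing k s with
  | zero =>
    refine ⟨_, s, Exec.loopDone ?_, ?_, rfl, hv⟩
    · simp only [Test.Holds, NExp.eval, hk, hb s hv]
      omega
    · simp only [Test.cost, NExp.cost]
      omega
  | succ m ih =>
    obtain ⟨t, s₁, hexec, ht, hreal, hnat⟩ := hP s hv
    obtain ⟨hD, hv₁⟩ := eqOn_update_iff.1 (hnat.trans (eqOn_update_iff.2 ⟨hk, hv⟩))
    obtain ⟨t', s₂, hexec', ht', hreal', hnat'⟩ := ih (k + 1) (by omega) (s₁.updNat D (k + 1))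
      (by rw [updNat_nat, Function.update_self])
      (fun r hr => by rw [updNat_nat, Function.update_of_ne (ne_of_lt hr), hv₁ hr])
    have hincr := Exec.setNat D (.add (.reg D) (.lit 1)) s₁
    simp only [NExp.eval, hD] at hincr
    refine ⟨_, s₂, Exec.loopStep ?_ (Exec.seq hexec hincr) hexec', ?_, ?_, hnat'⟩
    · simp only [Test.Holds, NExp.eval, hk, hb s hv]
      omega
    · simp only [Test.cost, NExp.cost]
      linarith
    · rw [hreal', List.range'_succ, List.foldl_cons, ← hf (eqOn_update_iff.2 ⟨hk, hv⟩), ← hreal]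
      rfl

namespace Computes

variable {D : ℕ} {P Q : Prog} {f g : (ℕ → ℕ) → Mem → Mem}

theorem skip (D : ℕ) : Computes D .skip fun _ R => R where
  dependsOn _ _ _ := rfl
  exists_exec := ⟨1, fun s => ⟨1, s, Exec.skip s, by simp, rfl, fun _ _ => rfl⟩⟩

theorem setReal {a : ℕ} {i j : NExp} {e : RExp} (hf : DependsOn f (Set.Iio D))
    (heval : ∀ s : Store, (s.updReal a (i.eval s) (j.eval s) (e.eval s)).real = f s.nat s.real) :
    Computes D (.setReal a i j e) f where
  dependsOn := hf
  exists_exec := ⟨Polynomial.C (i.cost + j.cost + e.cost + 1), fun s =>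
    ⟨_, _, Exec.setReal a i j e s, by rw [Polynomial.eval_C], heval s, fun _ _ => rfl⟩⟩

theorem of_le {D' : ℕ} (h : Computes D' P f) (hD : D ≤ D') (hf : DependsOn f (Set.Iio D)) :
    Computes D P f where
  dependsOn := hf
  exists_exec := by
    obtain ⟨p, hp⟩ := h.exists_exec
    refine ⟨p, fun s => ?_⟩
    obtain ⟨t, s', hexec, ht, hreal, hnat⟩ := hp s
    exact ⟨t, s', hexec, ht, hreal, hnat.mono (Set.Iio_subset_Iio hD)⟩

theorem seq (hD : 2 ≤ D) (hP : Computes D P f) (hQ : Computes D Q g) :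
    Computes D (.seq P Q) fun v R => g v (f v R) where
  dependsOn v v' h := by simp only [hP.dependsOn h, hQ.dependsOn h]
  exists_exec := by
    obtain ⟨p, hp⟩ := hP.exists_exec
    obtain ⟨q, hq⟩ := hQ.exists_exec
    refine ⟨p + q, fun s => ?_⟩
    obtain ⟨t, s₁, hexec, ht, hreal, hnat⟩ := hp s
    obtain ⟨t', s₂, hexec', ht', hreal', hnat'⟩ := hq s₁
    rw [hnat (show 0 < D by omega), hnat (show 1 < D by omega)] at ht'
    refine ⟨_, s₂, Exec.seq hexec hexec', ?_, ?_, hnat'.trans hnat⟩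
    · rw [Polynomial.eval_add]
      exact add_le_add ht ht'
    · rw [hreal', hreal, hQ.dependsOn hnat]

open Classical in
theorem cond {b : Test} {p : (ℕ → ℕ) → Mem → Prop} (hp : DependsOn p (Set.Iio D))
    (hb : ∀ s : Store, b.Holds s ↔ p s.nat s.real) (hP : Computes D P f) (hQ : Computes D Q g) :
    Computes D (.cond b P Q) fun v R => if p v R then f v R else g v R where
  dependsOn v v' h := by simp only [hp h, hP.dependsOn h, hQ.dependsOn h]
  exists_exec := by
    obtain ⟨pP, hpP⟩ := hP.exists_exec
    obtain ⟨pQ, hpQ⟩ := hQ.exists_exec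
    refine ⟨Polynomial.C (b.cost + 1) + (pP + pQ), fun s => ?_⟩
    simp only [Polynomial.eval_add, Polynomial.eval_C]
    by_cases h : b.Holds s
    · obtain ⟨t, s', hexec, ht, hreal, hnat⟩ := hpP s
      exact ⟨_, s', Exec.condTrue h hexec, by omega, by rw [hreal, if_pos ((hb s).1 h)], hnat⟩
    · obtain ⟨t, s', hexec, ht, hreal, hnat⟩ := hpQ s
      exact ⟨_, s', Exec.condFalse h hexec, by omega, by rw [hreal, if_neg (mt (hb s).2 h)], hnat⟩

theorem forLoop {b : NExp} {N : ℕ → ℕ → ℕ} (hD : 2 ≤ D) (hb : IsSize b N)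
    (hP : Computes (D + 1) P f) :
    Computes D (forLoop D b P) fun v R =>
      (List.range (N (v 0) (v 1))).foldl (fun R l => f (Function.update v D l) R) R where
  dependsOn v v' h := by
    have hupdate (l : ℕ) : f (Function.update v D l) = f (Function.update v' D l) :=
      hP.dependsOn (eqOn_update_iff.2 ⟨Function.update_self .., fun r hr => by
        rw [Function.update_of_ne (ne_of_lt hr), h r hr]⟩)
    simp only [hupdate, h 0 (show 0 < D by omega), h 1 (show 1 < D by omega)]
  exists_exec := by
    obtain ⟨p, hp⟩ := hP.exists_exec
    refine ⟨2 + (Polynomial.X + 2) * (p + Polynomial.C b.cost + 9), fun s => ?_⟩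
    obtain ⟨t, s', hexec, ht, hreal, hnat⟩ := exists_exec_countingLoop (b := b) (v := s.nat)
      (T := p.eval (s.nat 0 + s.nat 1)) (N := N (s.nat 0) (s.nat 1)) hP.dependsOn
      (fun s' h => by
        rw [hb.eval_eq, h (show 0 < D by omega), h (show 1 < D by omega)])
      (fun s' h => by
        have := hp s'
        rwa [h (show 0 < D by omega), h (show 1 < D by omega)] at this)
      (N (s.nat 0) (s.nat 1)) 0 (zero_add _) (s.updNat D 0)
      (by rw [updNat_nat, Function.update_self])
      (fun r hr => by rw [updNat_nat, Function.update_of_ne (ne_of_lt hr)])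
    refine ⟨_, s', Exec.seq (Exec.setNat D (.lit 0) s) hexec, ?_, ?_, hnat⟩
    · simp only [NExp.cost, Polynomial.eval_add, Polynomial.eval_mul, Polynomial.eval_X,
        Polynomial.eval_C, Polynomial.eval_ofNat]
      have hN : N (s.nat 0) (s.nat 1) + 1 ≤ s.nat 0 + s.nat 1 + 2 :=
        Nat.succ_le_succ (hb.le_add _ _)
      exact add_le_add_right (ht.trans (Nat.mul_le_mul_right _ hN)) 2
    · rw [hreal, List.range_eq_range']
      rfl

end Computes

/-! ### Filling arrays by nested loops -/

open Classical in
/-- The arrays `R` with the entries of array `a` at the positions in `s` replaced by those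
of `x`. -/
noncomputable def overwrite (a : ℕ) (s : Set (ℕ × ℕ)) (x : ℕ → ℕ → ℝ) (R : Mem) : Mem :=
  fun a' i j => if a' = a ∧ (i, j) ∈ s then x i j else R a' i j

section Overwrite

variable {a : ℕ} {s t : Set (ℕ × ℕ)} {x y : ℕ → ℕ → ℝ} {R : Mem}

theorem overwrite_of_ne {a' : ℕ} (h : a' ≠ a) : overwrite a s x R a' = R a' := by
  funext i j
  exact if_neg fun h' => h h'.1

theorem overwrite_of_mem {i j : ℕ} (h : (i, j) ∈ s) : overwrite a s x R a i j = x i j :=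
  if_pos ⟨rfl, h⟩

theorem overwrite_empty : overwrite a ∅ x R = R := by
  funext a' i j
  exact if_neg fun h => h.2

theorem overwrite_overwrite : overwrite a s x (overwrite a t x R) = overwrite a (t ∪ s) x R := by
  funext a' i j
  by_cases ha : a' = a <;> by_cases hs : (i, j) ∈ s <;> by_cases ht : (i, j) ∈ t <;>
    simp [overwrite, ha, hs, ht]

theorem overwrite_overwrite_of_subset (h : t ⊆ s) :
    overwrite a s x (overwrite a t y R) = overwrite a s x R := by
  funext a' i j
  simp only [overwrite]
  split_ifs with h₁ h₂
  exacts [rfl, absurd ⟨h₂.1, h h₂.2⟩ h₁, rfl]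

theorem overwrite_congr (h : ∀ i j, (i, j) ∈ s → x i j = y i j) :
    overwrite a s x R = overwrite a s y R := by
  funext a' i j
  simp only [overwrite]
  split_ifs with h'
  exacts [h i j h'.2, rfl]

theorem apply_overwrite {α : Type*} {φ : Mem → α} (hφ : DependsOn φ {a}ᶜ) :
    φ (overwrite a s x R) = φ R :=
  hφ fun _ h => overwrite_of_ne h

theorem foldl_overwrite {φ : Mem → ℕ → ℕ → ℝ} (hφ : DependsOn φ {a}ᶜ) (s : ℕ → Set (ℕ × ℕ))
    (M : ℕ) (R : Mem) :
    (List.range M).foldl (fun R k => overwrite a (s k) (φ R) R) R =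
      overwrite a (⋃ k < M, s k) (φ R) R := by
  induction M with
  | zero => simp [overwrite_empty]
  | succ M ih =>
    rw [List.range_succ, List.foldl_append, ih, List.foldl_cons, List.foldl_nil,
      apply_overwrite hφ, overwrite_overwrite, Set.biUnion_lt_succ]

theorem foldl_overwrite_accumulate {ψ : Mem → ℕ → ℕ → ℝ → ℕ → ℝ} (hψ : DependsOn ψ {a}ᶜ)
    (s : Set (ℕ × ℕ)) (L : ℕ) (R : Mem) :
    (List.range L).foldl (fun R l => overwrite a s (fun i j => ψ R i j (R a i j) l) R)
        (overwrite a s (fun _ _ => 0) R) =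
      overwrite a s (fun i j => (List.range L).foldl (ψ R i j) 0) R := by
  induction L with
  | zero => rfl
  | succ L ih =>
    rw [List.range_succ, List.foldl_append, ih, List.foldl_cons, List.foldl_nil,
      apply_overwrite hψ, overwrite_overwrite_of_subset subset_rfl]
    refine overwrite_congr fun i j hij => ?_
    rw [overwrite_of_mem hij, List.foldl_append, List.foldl_cons, List.foldl_nil]

end Overwrite

/-- The arrays `R` with the upper left `N × M` block of array `a` replaced by that of `φ R`. -/
noncomputable def fill (a N M : ℕ) (φ : Mem → ℕ → ℕ → ℝ) (R : Mem) : Mem :=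
  overwrite a (Set.Iio N ×ˢ Set.Iio M) (φ R) R

section Fill

variable {a N M : ℕ} {φ : Mem → ℕ → ℕ → ℝ} {R : Mem}

theorem fill_of_ne {a' : ℕ} (h : a' ≠ a) : fill a N M φ R a' = R a' :=
  overwrite_of_ne h

theorem fill_self {i j : ℕ} (hi : i < N) (hj : j < M) : fill a N M φ R a i j = φ R i j :=
  overwrite_of_mem ⟨hi, hj⟩

end Fill

/-- The register of the row index. -/
abbrev row : NExp := .reg 4

/-- The register of the column index. -/
abbrev col : NExp := .reg 5

/-- The register of the summation index. -/
abbrev idx : NExp := .reg 6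

/-- `P` stores in the current entry of array `a` a value computed from the arrays, the current
row and column, and the summation index. -/
def Assigns (a : ℕ) (P : Prog) (φ : Mem → ℕ → ℕ → ℕ → ℝ) : Prop :=
  Computes 7 P fun v R => overwrite a {(v 4, v 5)} (fun i j => φ R i j (v 6)) R

theorem assigns_setReal (a : ℕ) (e : RExp) (φ : Mem → ℕ → ℕ → ℕ → ℝ)
    (he : ∀ s : Store, e.eval s = φ s.real (s.nat 4) (s.nat 5) (s.nat 6)
      := by simp [RExp.eval, NExp.eval]) :
    Assigns a (.setReal a row col e) φ := by
  refine Computes.setReal (fun v v' h => ?_) fun s => ?_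
  · rw [h 4 (by decide), h 5 (by decide), h 6 (by decide)]
  · funext a' i j
    simp only [Store.updReal, NExp.eval, he, overwrite, Set.mem_singleton_iff, Prod.mk.injEq]
    split_ifs with h
    · rw [h.2.1, h.2.2]
    · rfl

open Classical in
theorem Assigns.cond {a : ℕ} {P Q : Prog} {φ ψ : Mem → ℕ → ℕ → ℕ → ℝ}
    (hP : Assigns a P φ) (hQ : Assigns a Q ψ) (b : Test) (p : Mem → ℕ → ℕ → ℕ → Prop)
    (hb : ∀ s : Store, b.Holds s ↔ p s.real (s.nat 4) (s.nat 5) (s.nat 6)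
      := by simp [Test.Holds, RExp.eval, NExp.eval]) :
    Assigns a (.cond b P Q) fun R i j l => if p R i j l then φ R i j l else ψ R i j l := by
  have h := Computes.cond (p := fun v R => p R (v 4) (v 5) (v 6)) (fun v v' h => by
    simp only [h 4 (by decide), h 5 (by decide), h 6 (by decide)]) hb hP hQ
  rw [Assigns]
  convert h using 3 with v R
  split_ifs with hp <;> refine overwrite_congr fun i j hij => ?_ <;>
    obtain ⟨rfl, rfl⟩ := Prod.mk.injEq .. ▸ Set.mem_singleton_iff.1 hij
  exacts [if_pos hp, if_neg hp]

/-- Executes `P` for all positions of the upper left `b × c` block of an array. -/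
def forEntries (b c : NExp) (P : Prog) : Prog :=
  forLoop 4 b (forLoop 5 c P)

/-- Sets the current entry of array `a` to zero and executes `P` for all values of the summation
index less than `c`. -/
def accumulate (a : ℕ) (c : NExp) (P : Prog) : Prog :=
  .seq (.setReal a row col (.lit 0)) (forLoop 6 c P)

section Loops

variable {a : ℕ} {b c e : NExp} {N M L : ℕ → ℕ → ℕ} {P : Prog}

theorem Computes.forEntries {φ : ℕ → ℕ → Mem → ℕ → ℕ → ℝ} (hb : IsSize b N) (hc : IsSize c M)
    (hP : Computes 6 P fun v R => overwrite a {(v 4, v 5)} (φ (v 0) (v 1) R) R)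
    (hφ : ∀ n d, DependsOn (φ n d) {a}ᶜ) :
    Computes 4 (forEntries b c P) fun v =>
      fill a (N (v 0) (v 1)) (M (v 0) (v 1)) (φ (v 0) (v 1)) := by
  convert (hP.forLoop (by decide) hc).forLoop (by decide) hb using 3 with v R
  · rfl
  · simp only [Function.update_apply, Nat.reduceEqDiff, OfNat.zero_ne_ofNat, OfNat.one_ne_ofNat,
      if_true, if_false, foldl_overwrite (hφ _ _)]
    rw [fill]
    congr 1
    ext ⟨i, j⟩
    simp

theorem Assigns.computes_fill {φ : Mem → ℕ → ℕ → ℝ} (hP : Assigns a P fun R i j _ => φ R i j)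
    (hb : IsSize b N) (hc : IsSize c M) (hφ : DependsOn φ {a}ᶜ) :
    Computes 4 (forEntries b c P) fun v => fill a (N (v 0) (v 1)) (M (v 0) (v 1)) φ :=
  Computes.forEntries hb hc (φ := fun _ _ => φ)
    (hP.of_le (by decide) fun v v' h => by simp only [h 4 (by decide), h 5 (by decide)])
    fun _ _ => hφ

theorem Assigns.computes_accumulate {ψ : Mem → ℕ → ℕ → ℝ → ℕ → ℝ}
    (hP : Assigns a P fun R i j l => ψ R i j (R a i j) l) (he : IsSize e L)
    (hψ : DependsOn ψ {a}ᶜ) :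
    Computes 6 (accumulate a e P) fun v R => overwrite a {(v 4, v 5)}
      (fun i j => (List.range (L (v 0) (v 1))).foldl (ψ R i j) 0) R := by
  have hzero : Computes 6 (.setReal a row col (.lit 0))
      fun v R => overwrite a {(v 4, v 5)} (fun _ _ => 0) R :=
    (assigns_setReal a _ fun _ _ _ _ => 0).of_le (by decide)
      fun v v' h => by simp only [h 4 (by decide), h 5 (by decide)]
  convert hzero.seq (by decide) (hP.forLoop (by decide) he) using 3 with v R
  · rfl
  · simp only [Function.update_apply, Nat.reduceEqDiff, if_true, if_false]
    exact (foldl_overwrite_accumulate hψ _ _ _).symm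

theorem Assigns.computes_fill_foldl {ψ : Mem → ℕ → ℕ → ℝ → ℕ → ℝ}
    (hP : Assigns a P fun R i j l => ψ R i j (R a i j) l) (hb : IsSize b N) (hc : IsSize c M)
    (he : IsSize e L) (hψ : DependsOn ψ {a}ᶜ) :
    Computes 4 (forEntries b c (accumulate a e P)) fun v =>
      fill a (N (v 0) (v 1)) (M (v 0) (v 1)) fun R i j =>
        (List.range (L (v 0) (v 1))).foldl (ψ R i j) 0 :=
  Computes.forEntries (φ := fun n d R i j => (List.range (L n d)).foldl (ψ R i j) 0) hb hc
    (hP.computes_accumulate he hψ) fun _ _ R R' h => by simp only [hψ h]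

theorem foldl_add_eq_sum_range (f : ℕ → ℝ) (k : ℕ) :
    (List.range k).foldl (fun acc l => acc + f l) 0 = ∑ l ∈ Finset.range k, f l := by
  induction k with
  | zero => rfl
  | succ k ih =>
    rw [List.range_succ, List.foldl_append, ih, List.foldl_cons, List.foldl_nil,
      Finset.sum_range_succ]

end Loops

/-- A program together with its effect on the arrays, which depends on the contents `n` and `d` of
the first two registers only, and with the set of arrays it may change. The program preserves the
registers below `D`. -/
structure Routine (D : ℕ) where
  prog : Prog
  effect : ℕ → ℕ → Mem → Mem
  computes : Computes D prog fun v => effect (v 0) (v 1)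
  writes : Finset ℕ
  effect_of_notMem : ∀ {n d : ℕ} {R : Mem} {a : ℕ}, a ∉ writes → effect n d R a = R a

namespace Routine

variable {D : ℕ}

def lower {D' : ℕ} (A : Routine D') (hD : 2 ≤ D := by decide) (h : D ≤ D' := by decide) :
    Routine D where
  prog := A.prog
  effect := A.effect
  computes := A.computes.of_le h fun v v' hv => by
    simp only [hv 0 (show 0 < D by omega), hv 1 (show 1 < D by omega)]
  writes := A.writes
  effect_of_notMem := A.effect_of_notMem

def seq (A B : Routine D) (hD : 2 ≤ D := by decide) : Routine D where
  prog := .seq A.prog B.prog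
  effect n d := B.effect n d ∘ A.effect n d
  computes := Computes.seq (f := fun v => A.effect (v 0) (v 1)) hD A.computes B.computes
  writes := A.writes ∪ B.writes
  effect_of_notMem h := by
    obtain ⟨hA, hB⟩ := Finset.notMem_union.1 h
    exact (B.effect_of_notMem hB).trans (A.effect_of_notMem hA)

open Classical in
noncomputable def onlyIf (A : Routine D) (b : Test) (p : Mem → Prop)
    (hb : ∀ s : Store, b.Holds s ↔ p s.real := by simp [Test.Holds, RExp.eval, NExp.eval]) :
    Routine D where
  prog := .cond b A.prog .skip
  effect n d R := if p R then A.effect n d R else R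
  computes := Computes.cond (p := fun _ => p) (fun _ _ _ => rfl) hb A.computes (Computes.skip D)
  writes := A.writes
  effect_of_notMem h := by
    split_ifs
    exacts [A.effect_of_notMem h, rfl]

def iterate (A : Routine (D + 1)) {b : NExp} {N : ℕ → ℕ → ℕ} (hb : IsSize b N)
    (hD : 2 ≤ D := by decide) : Routine D where
  prog := forLoop D b A.prog
  effect n d := (A.effect n d)^[N n d]
  computes := by
    convert A.computes.forLoop hD hb using 3 with v R
    simp only [Function.update_of_ne (show 0 ≠ D by omega),
      Function.update_of_ne (show 1 ≠ D by omega), List.foldl_const, List.length_range]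
  writes := A.writes
  effect_of_notMem {n d R a} h :=
    congrFun (Function.iterate_invariant (g := fun R : Mem => R a)
      (funext fun _ => A.effect_of_notMem h) _) R

variable {b c e : NExp} {N M L : ℕ → ℕ → ℕ}

noncomputable def fill {a : ℕ} (hb : IsSize b N) (hc : IsSize c M) {P : Prog}
    {φ : Mem → ℕ → ℕ → ℝ} (hP : Assigns a P fun R i j _ => φ R i j)
    (hφ : DependsOn φ {a}ᶜ := by exact fun R R' h => by simp [h]) : Routine 4 where
  prog := forEntries b c P
  effect n d := RealRAM.fill a (N n d) (M n d) φ
  computes := hP.computes_fill hb hc hφ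
  writes := {a}
  effect_of_notMem h := fill_of_ne (Finset.notMem_singleton.1 h)

open Classical in
/-- Every entry is computed by the loop `x := 0; for l do if p x l then x := φ x l`. -/
noncomputable def fillFold (a : ℕ) (hb : IsSize b N) (hc : IsSize c M) (he : IsSize e L)
    (q : Test) (t : RExp) (p : Mem → ℕ → ℕ → ℝ → ℕ → Prop) (φ : Mem → ℕ → ℕ → ℝ → ℕ → ℝ)
    (hq : ∀ s : Store, q.Holds s ↔
      p s.real (s.nat 4) (s.nat 5) (s.real a (s.nat 4) (s.nat 5)) (s.nat 6)
      := by simp [Test.Holds, RExp.eval, NExp.eval])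
    (ht : ∀ s : Store, t.eval s =
      φ s.real (s.nat 4) (s.nat 5) (s.real a (s.nat 4) (s.nat 5)) (s.nat 6)
      := by simp [RExp.eval, NExp.eval])
    (hp : DependsOn p {a}ᶜ := by exact fun R R' h => by simp [h])
    (hφ : DependsOn φ {a}ᶜ := by exact fun R R' h => by simp [h]) : Routine 4 where
  prog := forEntries b c (accumulate a e
    (.cond q (.setReal a row col t) (.setReal a row col (.get a row col))))
  effect n d := RealRAM.fill a (N n d) (M n d) fun R i j =>
    (List.range (L n d)).foldl (fun x l => if p R i j x l then φ R i j x l else x) 0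
  computes := Assigns.computes_fill_foldl
    (ψ := fun R i j x l => if p R i j x l then φ R i j x l else x)
    ((assigns_setReal a t (fun R i j l => φ R i j (R a i j) l) ht).cond
      (assigns_setReal a _ fun R i j _ => R a i j) q (fun R i j l => p R i j (R a i j) l) hq)
    hb hc he fun R R' h => by simp only [hp h, hφ h]
  writes := {a}
  effect_of_notMem h := fill_of_ne (Finset.notMem_singleton.1 h)

noncomputable def fillSum (a : ℕ) (hb : IsSize b N) (hc : IsSize c M) (he : IsSize e L) (t : RExp)
    (φ : Mem → ℕ → ℕ → ℕ → ℝ)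
    (ht : ∀ s : Store, t.eval s = φ s.real (s.nat 4) (s.nat 5) (s.nat 6)
      := by simp [RExp.eval, NExp.eval])
    (hφ : DependsOn φ {a}ᶜ := by exact fun R R' h => by simp [h]) : Routine 4 where
  prog := forEntries b c (accumulate a e (.setReal a row col (.add (.get a row col) t)))
  effect n d := RealRAM.fill a (N n d) (M n d) fun R i j => ∑ l ∈ Finset.range (L n d), φ R i j l
  computes := by
    simp only [← foldl_add_eq_sum_range]
    exact Assigns.computes_fill_foldl (ψ := fun R i j x l => x + φ R i j l)
      (assigns_setReal a _ (fun R i j l => R a i j + φ R i j l) fun s => by rw [RExp.eval, ht]; rfl)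
      hb hc he fun R R' h => by simp only [hφ h]
  writes := {a}
  effect_of_notMem h := fill_of_ne (Finset.notMem_singleton.1 h)

end Routine

/-! ### The program -/

-- The addresses 0, 1 and 2 are dictated by `inputStore` and `outputVec`.
abbrev pointArray : ℕ := 0
abbrev epsArray : ℕ := 1
abbrev meanArray : ℕ := 2
abbrev weightArray : ℕ := 3
abbrev powerArray : ℕ := 4
abbrev squareArray : ℕ := 5
abbrev scoreArray : ℕ := 6
abbrev rankArray : ℕ := 7
abbrev maxArray : ℕ := 8
abbrev loweredArray : ℕ := 9
abbrev removedArray : ℕ := 10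
abbrev countArray : ℕ := 11
abbrev totalArray : ℕ := 12
abbrev imageArray : ℕ := 13

/-- Entry `(i, 0)` of array `a`: the value of a variable that depends on the point `i`. -/
abbrev pointVar (a : ℕ) (i : NExp) : RExp := .get a i (.lit 0)

/-- Entry `(0, 0)` of array `a`: the value of a single real variable. -/
abbrev scalarVar (a : ℕ) : RExp := .get a (.lit 0) (.lit 0)

/-- Coordinate `j` of point `i`, centered at the mean. -/
abbrev centeredEntry (i j : NExp) : RExp := .sub (.get pointArray i j) (.get meanArray (.lit 0) j)

/-- The weighted score of point `i`. -/
abbrev weightedScore (i : NExp) : RExp := .mul (pointVar weightArray i) (pointVar scoreArray i)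

/-- Test whether point `i` is in the top set. -/
abbrev isTop (i : NExp) : Test :=
  .realLe (.add (pointVar rankArray i) (.lit 1)) (.mul (scalarVar epsArray) (scalarVar countArray))

/-- Counts the points, which makes the integer `n` available as a real number, and sets all
weights to one. -/
noncomputable def initRoutine : Routine 4 :=
  .seq (.fillSum countArray isSize_one isSize_one isSize_fst (.lit 1) fun _ _ _ _ => 1)
    (.fill isSize_fst isSize_one (assigns_setReal weightArray (.lit 1) fun _ _ _ _ => 1))

/-- Stores the weighted mean of the points in row `0` of `meanArray`. -/
noncomputable def meanRoutine : Routine 4 :=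
  .seq
    (.fillSum totalArray isSize_one isSize_one isSize_fst (pointVar weightArray idx)
      fun R _ _ l => R weightArray l 0)
    (.fillSum meanArray isSize_one isSize_snd isSize_fst
      (.div (.mul (pointVar weightArray idx) (.get pointArray idx col)) (scalarVar totalArray))
      fun R _ j l => R weightArray l 0 * R pointArray l j / R totalArray 0 0)

/-- Stores the scatter matrix about the stored mean in `powerArray`. -/
noncomputable def scatterRoutine : Routine 4 :=
  .fillSum powerArray isSize_snd isSize_snd isSize_fst
    (.mul (pointVar weightArray idx) (.mul (centeredEntry idx row) (centeredEntry idx col)))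
    fun R i j l => R weightArray l 0 *
      ((R pointArray l i - R meanArray 0 i) * (R pointArray l j - R meanArray 0 j))

/-- Squares the matrix in `powerArray`. -/
noncomputable def squareRoutine : Routine 4 :=
  .seq
    (.fillSum squareArray isSize_snd isSize_snd isSize_snd
      (.mul (.get powerArray row idx) (.get powerArray idx col))
      fun R i j l => R powerArray i l * R powerArray l j)
    (.fill isSize_snd isSize_snd
      (assigns_setReal powerArray (.get squareArray row col) fun R i j _ => R squareArray i j))

/-- Evaluates the quadratic form of the matrix in `powerArray` at the centered points. -/
noncomputable def scoreRoutine : Routine 4 :=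
  .seq
    (.fillSum imageArray isSize_fst isSize_snd isSize_snd
      (.mul (.get powerArray col idx) (centeredEntry row idx))
      fun R i j l => R powerArray j l * (R pointArray i l - R meanArray 0 l))
    (.fillSum scoreArray isSize_fst isSize_one isSize_snd
      (.mul (centeredEntry row idx) (.get imageArray row idx))
      fun R i _ l => (R pointArray i l - R meanArray 0 l) * R imageArray i l)

/-- Computes the outlier scores of all points from the weights. -/
noncomputable def weightToScoreRoutine : Routine 3 :=
  (((meanRoutine.seq scatterRoutine).lower).seq (squareRoutine.iterate isSize_add)).seq
    scoreRoutine.lower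

/-- Stores the descending ranks of the weighted scores `x` in `rankArray`: point `i` counts the
points `l` that precede it. For lack of a disjunction and of an equality test, the test for this is
the negation of `x l ≤ x i ∧ ¬ (x i ≤ x l ∧ l < i)`. -/
noncomputable def rankRoutine : Routine 4 :=
  .fillFold rankArray isSize_fst isSize_one isSize_fst
    (.not (.and (.realLe (weightedScore idx) (weightedScore row))
      (.not (.and (.realLe (weightedScore row) (weightedScore idx))
        (.natLe (.add idx (.lit 1)) row)))))
    (.add (.get rankArray row col) (.lit 1))
    (fun R i _ _ l => R weightArray i 0 * R scoreArray i 0 < R weightArray l 0 * R scoreArray l 0 ∨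
      R weightArray i 0 * R scoreArray i 0 = R weightArray l 0 * R scoreArray l 0 ∧ l < i)
    (fun _ _ _ x _ => x + 1)
    (fun s => by simp only [Test.Holds, RExp.eval, NExp.eval]; grind)

/-- Stores the largest score of a top point of positive weight in `maxArray`. -/
noncomputable def maxRoutine : Routine 4 :=
  .fillFold maxArray isSize_one isSize_one isSize_fst
    (.and (.and (isTop idx) (.not (.realLe (pointVar weightArray idx) (.lit 0))))
      (.realLe (.get maxArray row col) (pointVar scoreArray idx)))
    (pointVar scoreArray idx)
    (fun R _ _ x l => (R rankArray l 0 + 1 ≤ R epsArray 0 0 * R countArray 0 0 ∧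
      0 < R weightArray l 0) ∧ x ≤ R scoreArray l 0)
    fun R _ _ _ l => R scoreArray l 0

/-- Stores the lowered weights in `loweredArray`, without committing to them. -/
noncomputable def lowerRoutine : Routine 4 :=
  .fill isSize_fst isSize_one
    ((assigns_setReal loweredArray (.sub (pointVar weightArray row)
        (.div (weightedScore row) (scalarVar maxArray)))
      fun R i _ _ => R weightArray i 0 - R weightArray i 0 * R scoreArray i 0 / R maxArray 0 0).cond
      (assigns_setReal loweredArray (pointVar weightArray row) fun R i _ _ => R weightArray i 0)
      (isTop row) fun R i _ _ => R rankArray i 0 + 1 ≤ R epsArray 0 0 * R countArray 0 0)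

/-- Stores the weight removed altogether by the lowered weights in `removedArray`. -/
noncomputable def removedRoutine : Routine 4 :=
  .fillSum removedArray isSize_one isSize_one isSize_fst
    (.sub (.lit 1) (pointVar loweredArray idx)) fun R _ _ l => 1 - R loweredArray l 0

/-- Adopts the lowered weights if the weight removed is at most twice the corruption bound. -/
noncomputable def acceptRoutine : Routine 4 :=
  .onlyIf
    (.fill isSize_fst isSize_one
      (assigns_setReal weightArray (pointVar loweredArray row) fun R i _ _ => R loweredArray i 0))
    (.realLe (scalarVar removedArray)
      (.mul (.lit 2) (.mul (scalarVar epsArray) (scalarVar countArray))))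
    fun R => R removedArray 0 0 ≤ 2 * (R epsArray 0 0 * R countArray 0 0)

/-- One step of the filter on the weights. -/
noncomputable def stepRoutine : Routine 3 :=
  weightToScoreRoutine.seq
    ((((rankRoutine.seq maxRoutine).seq lowerRoutine).seq removedRoutine).seq acceptRoutine).lower

/-- The whole algorithm: `n` steps of the filter from unit weights, then the weighted mean. -/
noncomputable def filterRoutine : Routine 2 :=
  (initRoutine.lower.seq (stepRoutine.iterate isSize_fst)).seq meanRoutine.lower

/-! ### Correctness of the program -/

section Correctness

variable {n d : ℕ}

/-- The arrays `R` hold the points `y`, their number, the parameter `ε` and the weights `w`. -/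
structure Represents (y : Points n d) (ε : ℝ) (w : Fin n → ℝ) (R : Mem) : Prop where
  point_eq : ∀ (i : Fin n) (j : Fin d), R pointArray i j = y i j
  count_eq : R countArray 0 0 = n
  eps_eq : R epsArray 0 0 = ε
  weight_eq : ∀ i : Fin n, R weightArray i 0 = w i

variable {y : Points n d} {ε : ℝ} {w g : Fin n → ℝ} {R : Mem}

theorem Represents.effect {D : ℕ} (h : Represents y ε w R) (A : Routine D)
    (hA : Disjoint {pointArray, epsArray, weightArray, countArray} A.writes := by decide) :
    Represents y ε w (A.effect n d R) := by
  have hframe {a : ℕ} (ha : a ∈ ({pointArray, epsArray, weightArray, countArray} : Finset ℕ)) :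
      A.effect n d R a = R a :=
    A.effect_of_notMem (Finset.disjoint_left.1 hA ha)
  constructor
  · rw [hframe (by decide)]; exact h.point_eq
  · rw [hframe (by decide)]; exact h.count_eq
  · rw [hframe (by decide)]; exact h.eps_eq
  · rw [hframe (by decide)]; exact h.weight_eq

theorem initRoutine_represents (y : Points n d) (ε : ℝ) :
    Represents y ε 1 (initRoutine.effect n d (inputStore y ε).real) where
  point_eq i j := by
    rw [Routine.effect_of_notMem _ (by decide)]
    simp [inputStore]
  count_eq := by
    simp [initRoutine, Routine.seq, Routine.fillSum, Routine.fill, fill_of_ne, fill_self]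
  eps_eq := by
    rw [Routine.effect_of_notMem _ (by decide)]
    simp [inputStore]
  weight_eq i := by
    simp only [initRoutine, Routine.seq, Routine.fill, Function.comp_apply, fill_self i.2 one_pos,
      Pi.one_apply]

theorem weightedMean_apply (y : Points n d) (w : Fin n → ℝ) (j : Fin d) :
    weightedMean y w j = ∑ i, w i * y i j / ∑ i, w i := by
  rw [weightedMean, Finset.centerMass, ← Finset.sum_div, div_eq_inv_mul]
  simp

theorem Represents.meanRoutine_effect (h : Represents y ε w R) (j : Fin d) :
    meanRoutine.effect n d R meanArray 0 j = weightedMean y w j := by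
  simp (disch := decide) only [meanRoutine, Routine.seq, Routine.fillSum, Function.comp_apply,
    fill_self one_pos j.2, fill_self one_pos one_pos, fill_of_ne]
  simp only [weightedMean_apply, Finset.sum_range, h.weight_eq, h.point_eq]

theorem Represents.scatterRoutine_effect (h : Represents y ε w R)
    (hmean : ∀ j : Fin d, R meanArray 0 j = weightedMean y w j) (i j : Fin d) :
    scatterRoutine.effect n d R powerArray i j = scatterMatrix y w i j := by
  simp only [scatterRoutine, Routine.fillSum, fill_self i.2 j.2, Finset.sum_range, h.weight_eq,
    h.point_eq, hmean]
  simp [scatterMatrix, Matrix.sum_apply, Matrix.vecMulVec_apply]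

theorem squareRoutine_effect {A : Matrix (Fin d) (Fin d) ℝ}
    (hA : ∀ i j : Fin d, R powerArray i j = A i j) (i j : Fin d) :
    squareRoutine.effect n d R powerArray i j = (A * A) i j := by
  simp only [squareRoutine, Routine.seq, Routine.fillSum, Routine.fill, Function.comp_apply,
    fill_self i.2 j.2, Finset.sum_range, hA, Matrix.mul_apply]

theorem iterate_squareRoutine_effect {A : Matrix (Fin d) (Fin d) ℝ}
    (hA : ∀ i j : Fin d, R powerArray i j = A i j) (k : ℕ) (i j : Fin d) :
    (squareRoutine.effect n d)^[k] R powerArray i j = (A ^ 2 ^ k) i j := by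
  induction k generalizing i j with
  | zero => simpa using hA i j
  | succ k ih => rw [Function.iterate_succ_apply', squareRoutine_effect ih, pow_succ, pow_mul, sq]

open Matrix in
theorem Represents.scoreRoutine_effect (h : Represents y ε w R)
    (hmean : ∀ j : Fin d, R meanArray 0 j = weightedMean y w j)
    {A : Matrix (Fin d) (Fin d) ℝ} (hA : ∀ i j : Fin d, R powerArray i j = A i j) (i : Fin n) :
    scoreRoutine.effect n d R scoreArray i 0 =
      (y i - weightedMean y w).ofLp ⬝ᵥ A *ᵥ (y i - weightedMean y w).ofLp := by
  simp (disch := decide) only [scoreRoutine, Routine.seq, Routine.fillSum, Function.comp_apply,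
    fill_self i.2 one_pos, fill_of_ne, Finset.sum_range, fill_self i.2 (Fin.is_lt _), h.point_eq,
    hmean, hA]
  simp [dotProduct, mulVec]

theorem Represents.weightToScoreRoutine_effect (h : Represents y ε w R) (i : Fin n) :
    weightToScoreRoutine.effect n d R scoreArray i 0 = outlierScore y w i := by
  have hmean := h.meanRoutine_effect
  have hscatter := (h.effect meanRoutine).scatterRoutine_effect hmean
  have hpower := iterate_squareRoutine_effect (n := n) hscatter (n + d)
  have hpoints := ((h.effect meanRoutine).effect scatterRoutine).effect
    (squareRoutine.iterate isSize_add)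
  rw [outlierScore, Fintype.card_fin, Fintype.card_fin]
  refine hpoints.scoreRoutine_effect (fun j => ?_) hpower i
  rw [Routine.effect_of_notMem _ (by decide), Routine.effect_of_notMem _ (by decide), hmean]

theorem Represents.rankRoutine_effect (h : Represents y ε w R)
    (hg : ∀ i : Fin n, R scoreArray i 0 = g i) (i : Fin n) :
    rankRoutine.effect n d R rankArray i 0 = descendingRank (fun i => w i * g i) i := by
  simp only [rankRoutine, Routine.fillFold, fill_self i.2 one_pos]
  have hfold (x : ℝ) (p : Prop) [Decidable p] :
      (if p then x + 1 else x) = x + if p then 1 else 0 := by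
    split_ifs <;> simp
  simp only [hfold, foldl_add_eq_sum_range, Finset.sum_range, h.weight_eq, hg]
  simp only [Finset.sum_boole, descendingRank, descendingKey_lt_iff, Fin.lt_def]

theorem Represents.isTop_iff (h : Represents y ε w R) {a : Fin n → ℝ}
    (hrank : ∀ i : Fin n, R rankArray i 0 = descendingRank a i) (i : Fin n) :
    R rankArray i 0 + 1 ≤ R epsArray 0 0 * R countArray 0 0 ↔ i ∈ topSet a (ε * n) := by
  rw [mem_topSet, hrank, h.eps_eq, h.count_eq]

theorem foldl_max_le_iff {p : ℕ → Prop} [DecidablePred p] {f : ℕ → ℝ} {k : ℕ} {c : ℝ} :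
    (List.range k).foldl (fun x l => if p l ∧ x ≤ f l then f l else x) 0 ≤ c ↔
      0 ≤ c ∧ ∀ l < k, p l → f l ≤ c := by
  induction k with
  | zero => simp
  | succ k ih =>
    rw [List.range_succ, List.foldl_append, List.foldl_cons, List.foldl_nil]
    rw [Nat.forall_lt_succ_right, ← and_assoc, ← ih]
    split_ifs with h
    · exact ⟨fun hc => ⟨h.2.trans hc, fun _ => hc⟩, fun hc => hc.2 h.1⟩
    · exact ⟨fun hc => ⟨hc, fun hp => (lt_of_not_ge fun hle => h ⟨hp, hle⟩).le.trans hc⟩, And.left⟩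

theorem Represents.maxRoutine_effect (h : Represents y ε w R)
    (hg : ∀ i : Fin n, R scoreArray i 0 = g i) {a : Fin n → ℝ}
    (hrank : ∀ i : Fin n, R rankArray i 0 = descendingRank a i) :
    maxRoutine.effect n d R maxArray 0 0 = maxScore w g (topSet a (ε * n)) := by
  refine eq_of_forall_ge_iff fun c => ?_
  simp only [maxRoutine, Routine.fillFold, fill_self one_pos one_pos]
  rw [foldl_max_le_iff, maxScore, Finset.fold_max_le]
  simp only [Finset.mem_filter, Fin.forall_iff]
  refine and_congr_right fun _ => forall₂_congr fun l hl => ?_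
  rw [← h.isTop_iff hrank, ← h.weight_eq, ← hg]

theorem Represents.lowerRoutine_effect (h : Represents y ε w R)
    (hg : ∀ i : Fin n, R scoreArray i 0 = g i) {a : Fin n → ℝ}
    (hrank : ∀ i : Fin n, R rankArray i 0 = descendingRank a i)
    (hmax : R maxArray 0 0 = maxScore w g (topSet a (ε * n))) (i : Fin n) :
    lowerRoutine.effect n d R loweredArray i 0 = downweight w g (topSet a (ε * n)) i := by
  simp only [lowerRoutine, Routine.fill, fill_self i.2 one_pos, h.isTop_iff hrank, h.weight_eq, hg,
    hmax, downweight]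

theorem removedRoutine_effect {u : Fin n → ℝ} (hu : ∀ i : Fin n, R loweredArray i 0 = u i) :
    removedRoutine.effect n d R removedArray 0 0 = ∑ i, (1 - u i) := by
  simp only [removedRoutine, Routine.fillSum, fill_self one_pos one_pos, Finset.sum_range, hu]

open Classical in
theorem Represents.acceptRoutine_effect (h : Represents y ε w R) {u : Fin n → ℝ}
    (hu : ∀ i : Fin n, R loweredArray i 0 = u i)
    (hremoved : R removedArray 0 0 = ∑ i, (1 - u i)) :
    Represents y ε (if ∑ i, (1 - u i) ≤ 2 * (ε * n) then u else w)
      (acceptRoutine.effect n d R) := by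
  simp only [acceptRoutine, Routine.onlyIf, hremoved, h.eps_eq, h.count_eq]
  split_ifs
  · constructor
    · rw [Routine.effect_of_notMem _ (by decide)]; exact h.point_eq
    · rw [Routine.effect_of_notMem _ (by decide)]; exact h.count_eq
    · rw [Routine.effect_of_notMem _ (by decide)]; exact h.eps_eq
    · intro i
      simp only [Routine.fill, fill_self i.2 one_pos, hu]
  · exact h

theorem Represents.stepRoutine_effect (h : Represents y ε w R) :
    Represents y ε (filterStep y (ε * n) w) (stepRoutine.effect n d R) := by
  have h₁ := h.effect weightToScoreRoutine
  have h₂ := h₁.effect rankRoutine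
  have h₃ := h₂.effect maxRoutine
  have h₄ := h₃.effect lowerRoutine
  have h₅ := h₄.effect removedRoutine
  have hscore := h.weightToScoreRoutine_effect
  have hrank := h₁.rankRoutine_effect hscore
  have hmax := h₂.maxRoutine_effect hscore hrank
  have hlower := h₃.lowerRoutine_effect hscore hrank hmax
  exact h₅.acceptRoutine_effect hlower (removedRoutine_effect hlower)

theorem Represents.iterate_stepRoutine_effect (h : Represents y ε w R) (k : ℕ) :
    Represents y ε ((filterStep y (ε * n))^[k] w) ((stepRoutine.effect n d)^[k] R) := by
  induction k with
  | zero => exact h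
  | succ k ih => simpa only [Function.iterate_succ_apply'] using ih.stepRoutine_effect

theorem filterRoutine_effect (y : Points n d) (ε : ℝ) (j : Fin d) :
    filterRoutine.effect n d (inputStore y ε).real meanArray 0 j =
      weightedMean y ((filterStep y (ε * n))^[n] 1) j :=
  ((initRoutine_represents y ε).iterate_stepRoutine_effect n).meanRoutine_effect j

end Correctness

end RealRAM

/-- The weighted mean after `n` steps of the filter from unit weights. -/
noncomputable def filterEstimator : Estimator := fun n _ y ε =>
  weightedMean y ((filterStep y (ε * n))^[n] 1)

theorem filterEstimator_isPolyTime : filterEstimator.IsPolyTime := by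
  obtain ⟨p, hp⟩ := RealRAM.filterRoutine.computes.exists_exec
  refine ⟨RealRAM.filterRoutine.prog, p, fun n d y ε => ?_⟩
  obtain ⟨t, s, hexec, ht, hreal, -⟩ := hp (RealRAM.inputStore y ε)
  refine ⟨t, s, hexec, ht, ?_⟩
  ext j
  exact (congrFun (congrFun (congrFun hreal _) _) _).trans (RealRAM.filterRoutine_effect y ε j)

theorem mainTheorem7 :
    ∃ F : Estimator, F.IsPolyTime ∧
      ∃ C₀ K : ℝ, 0 < C₀ ∧ 0 < K ∧
        ∀ C : ℝ, C₀ ≤ C →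
          ∀ (n d : ℕ) (S T : Points n d) (ε δ σ : ℝ), 0 < n → 0 < σ →
            IsCorruption ε S T →
            IsStable (C * ε) δ S (subMean S Finset.univ) σ →
            ‖subMean S Finset.univ - F n d T ε‖ ≤ K * (σ * δ) := by
  refine ⟨filterEstimator, filterEstimator_isPolyTime, 1000, 1, by norm_num, one_pos, ?_⟩
  intro C hC n d S T ε δ σ hn hσ hT hS
  rw [one_mul]
  exact hS.norm_subMean_sub_weightedMean_le hC hn hσ.le hT
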